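/- For a bounded set $E\subset\mathbb R$ let $PW_E$ be the space of entire functions $f(z)=\int_E\varphi(t)e^{itz}\,dt$, $\varphi\in L^2(E)$, with the inner product of $L^2(\mathbb R)$, and let $k^E_\lambda(z)=\frac1{2\pi}\int_E e^{it(z-\bar\lambda)}\,dt$ be its reproducing kernel at $\lambda\in\mathbb C$. Let $E=I^1\cup I^2$ be a union of two disjoint compact intervals of positive length, and let $\Lambda\subset\mathbb C$ be such that the system $\{k^E_\lambda\}_{\lambda\in\Lambda}$ is complete and minimal in $PW_E$ and $$\limsup_{R\to\infty}\frac{\#\{\lambda\in\Lambda:\ |\lambda|<R\}}{2R}=\frac{|E|}{2\pi},$$ where $|E|$ is the Lebesgue measure of $E$. Let $\{f_\lambda\}_{\lambda\in\Lambda}\subset PW_E$ be the system biorthogonal to $\{k^E_\lambda\}_{\lambda\in\Lambda}$. Let $\lambda_1,\lambda_2\in\Lambda$ be such that the functions $F_k(z)=(z-\lambda_k)f_{\lambda_k}(z)$, $k=1,2$, are linearly independent. Decompose $$F_1=F_1^1+F_1^2,\qquad F_2=F_2^1+F_2^2,$$ where $F_k^j$ has its spectrum in $I^j$, that is, $F_k^j\in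 PW_{I^j}+zPW_{I^j}$. Then: 1. There exist nonzero constants $c_\lambda$, $\lambda\in\Lambda$, such that for every $\lambda\in\Lambda$ and all $z\neq\lambda$ $$f_\lambda(z)=c_\lambda\frac{F_1^1(\lambda)F_2(z)-F_2^1(\lambda)F_1(z)}{z-\lambda}=c_\lambda\frac{F_2^2(\lambda)F_1(z)-F_1^2(\lambda)F_2(z)}{z-\lambda}.$$ 2. Put $S(z)=F_1^1(z)F_2^2(z)-F_1^2(z)F_2^1(z)$. Then $S(z)=F_1^1(z)F_2(z)-F_2^1(z)F_1(z)$, the zero set of $S$ coincides with $\Lambda$, and all zeros of $S$ are simple. 3. There is $t\in\mathbb R$ such that the function $e^{itz}S(z)$ is entire of exponential type and has conjugate indicator diagram $[0,i|E|]$. Here the conjugate indicator diagram of an entire function $g\not\equiv0$ of exponential type is the compact convex set $K\subset\mathbb C$ such that $$\limsup_{r\to\infty}\frac{\log|g(re^{i\theta})|}{r}=\max_{\zeta\in K}\operatorname{Re}(\zeta e^{i\theta})\qquad\text{for all }\theta\in\mathbb R.$$ -/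

import Mathlib

open MeasureTheory Filter Set
open scoped ENNReal ComplexConjugate

noncomputable section

/-- The Paley-Wiener space `PW_E` of a bounded set `E`: the functions
`f(z) = ∫_E φ(t) e^{itz} dt` with `φ ∈ L²(E)`. -/
def paleyWiener (E : Set ℝ) : Set (ℂ → ℂ) :=
  {f | ∃ φ : ℝ → ℂ, MemLp φ 2 (volume.restrict E) ∧
    ∀ z : ℂ, f z = ∫ t in E, φ t * Complex.exp (Complex.I * t * z)}

/-- The inner product of `PW_E`, namely that of `L²(ℝ)`; it is linear in the first argument. -/
def pwInner (f g : ℂ → ℂ) : ℂ := ∫ x : ℝ, f x * conj (g x)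

/-- The reproducing kernel `k_w^E` of `PW_E` at the point `w`. -/
def pwKernel (E : Set ℝ) (w : ℂ) : ℂ → ℂ := fun z =>
  1 / (2 * (Real.pi : ℂ)) * ∫ t in E, Complex.exp (Complex.I * t * (z - conj w))

/-- `f` lies in the closure, in the norm of `L²(ℝ)` (the norm of `PW_E`), of the linear span of
the set `s` of functions. -/
def InClosedSpan (s : Set (ℂ → ℂ)) (f : ℂ → ℂ) : Prop :=
  ∀ ε : ℝ≥0∞, 0 < ε → ∃ p ∈ Submodule.span ℂ s,
    eLpNorm (fun x : ℝ => f x - p x) 2 volume < ε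

/-- The system `{k_w^E}`, `w ∈ Λ`, is complete in `PW_E`. -/
def KernelsComplete (E : Set ℝ) (Λ : Set ℂ) : Prop :=
  ∀ f ∈ paleyWiener E, InClosedSpan (pwKernel E '' Λ) f

/-- The system `{k_w^E}`, `w ∈ Λ`, is minimal: no element lies in the closed span of the others. -/
def KernelsMinimal (E : Set ℝ) (Λ : Set ℂ) : Prop :=
  ∀ w ∈ Λ, ¬ InClosedSpan (pwKernel E '' (Λ \ {w})) (pwKernel E w)

/-- `{f_w}`, `w ∈ Λ`, is a system in `PW_E` biorthogonal to `{k_w^E}`, `w ∈ Λ`.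
Only the values `f w` with `w ∈ Λ` matter. -/
def IsBiorthogonal (E : Set ℝ) (Λ : Set ℂ) (f : ℂ → ℂ → ℂ) : Prop :=
  (∀ w ∈ Λ, f w ∈ paleyWiener E) ∧
  (∀ w ∈ Λ, pwInner (pwKernel E w) (f w) = 1) ∧
  (∀ w ∈ Λ, ∀ v ∈ Λ, w ≠ v → pwInner (pwKernel E w) (f v) = 0)

/-- The upper density `limsup_{R → ∞} #(Λ ∩ B(0, R)) / (2R)`. -/
def upperDensity (Λ : Set ℂ) : ℝ≥0∞ :=
  limsup (fun R : ℝ => ((Λ ∩ Metric.ball 0 R).encard : ℝ≥0∞) / ENNReal.ofReal (2 * R)) atTop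

/-- The space `PW_I + z PW_I`. Its elements have their spectrum (as tempered distributions)
in the closed interval `I`. -/
def paleyWienerAddZ (I : Set ℝ) : Set (ℂ → ℂ) :=
  {f | ∃ u ∈ paleyWiener I, ∃ v ∈ paleyWiener I, ∀ z : ℂ, f z = u z + z * v z}

/-- `f` is an entire function of exponential type. -/
def IsEntireExpType (f : ℂ → ℂ) : Prop :=
  Differentiable ℂ f ∧ ∃ A B : ℝ, ∀ z : ℂ, ‖f z‖ ≤ A * Real.exp (B * ‖z‖)

/-- The indicator `h_f(θ) = limsup_{r → ∞} log |f(r e^{iθ})| / r`, where `log 0 = -∞`. -/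
def indicatorFn (f : ℂ → ℂ) (θ : ℝ) : EReal :=
  limsup (fun r : ℝ =>
    ENNReal.log ‖f (r * Complex.exp (Complex.I * θ))‖ₑ / (r : EReal)) atTop

/-- `K` is the conjugate indicator diagram of the entire function `f` of exponential type: the
nonempty compact convex set `K` with `h_f(θ) = sup_{ζ ∈ K} Re (ζ e^{iθ})` for all `θ`
(so `K` is the complex conjugate of the convex set with support function `h_f`). -/
def HasConjIndicatorDiagram (f : ℂ → ℂ) (K : Set ℂ) : Prop :=
  IsEntireExpType f ∧ K.Nonempty ∧ IsCompact K ∧ Convex ℝ K ∧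
    ∀ θ : ℝ, indicatorFn f θ = ⨆ ζ ∈ K, (((ζ * Complex.exp (Complex.I * θ)).re : ℝ) : EReal)

end

/-! Biorthogonality and the reproducing property make `F₁` and `F₂` vanish on `Λ`, and completeness
makes `Λ` a uniqueness set for `PW_E`. Zeros can be divided out inside `PW_I + z PW_I` for an
interval `I`. Hence, if both components of `αF₁ + βF₂` vanish at `μ`, the combination is `(z - μ)v`
with `v ∈ PW_E`, and `v` vanishes on `Λ \ {μ}`. Unless `μ ∈ Λ` and `v(μ) ≠ 0`, this forces `v = 0`,
so `α = β = 0` by independence (`eq_zero_of_combination`). Since `S` is the determinant of the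
matrix of components, it has no zero off `Λ`. At `l ∈ Λ` the two components of each `F_k` are
opposite, so `S(l) = 0`, and one combination of `F₁`, `F₂` has both components zero at `l`. Its
quotient `v` is a nonzero multiple of `f_l`, which is the formula of part 1, and `S'(l) = v(l) ≠ 0`.

For part 3 put `L = |E|` and let `T = e^{itz} S` with `t` minus the sum of the left endpoints. Up to
a factor `(1 + |z|)²`, `T` has type `0` in the upper and `L` in the lower half-plane, which bounds
the indicator from above. If the indicator were smaller on some ray, Phragmén–Lindelöf would spread
exponential decay over a whole half-plane (`decay_of_decay_on_ray`), and the sum of the two types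
would drop below `L`. This contradicts the density of `Λ`, because types `h₁`, `h₂` allow at most
`(h₁ + h₂)R/π + o(R)` zeros in `|z| ≤ R` when `h₁ + h₂ ≥ 0` (`scaledCountLE_zeros`). That count
comes from Jensen's formula: after passing to optimal types the zeros away from the real axis have
density zero, and averaging Jensen's formula over many centres near the axis gives the sharp
constant for the others. -/

/-! ### Plancherel's theorem for Fourier integrals. -/

section Plancherel
open scoped FourierTransform SchwartzMap

theorem continuous_fourier_of_integrable {φ : ℝ → ℂ} (h : Integrable φ) : Continuous (𝓕 φ) :=
  VectorFourier.fourierIntegral_continuous Real.continuous_fourierChar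
    (by exact continuous_inner) h

/-- The `L²` Fourier transform of an integrable square integrable function is its Fourier
integral. -/
theorem fourier_toLp_ae_eq {φ : ℝ → ℂ} (h1 : Integrable φ) (h2 : MemLp φ 2) :
    ((𝓕 (h2.toLp φ) : Lp ℂ 2 (volume : Measure ℝ)) : ℝ → ℂ) =ᵐ[volume] 𝓕 φ := by
  apply ae_eq_of_integral_contDiff_smul_eq
  · exact (Lp.memLp _).locallyIntegrable (by norm_num)
  · exact (continuous_fourier_of_integrable h1).locallyIntegrable
  · intro g hg hgc
    have hg₁ : HasCompactSupport (Complex.ofRealCLM ∘ g) := hgc.comp_left rfl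
    have hg₂ : ContDiff ℝ (⊤ : ℕ∞) (Complex.ofRealCLM ∘ g) := by fun_prop
    set G : 𝓢(ℝ, ℂ) := hg₁.toSchwartzMap hg₂
    -- As tempered distributions, the `L²` transform paired with `G` equals `φ` paired with `𝓕 G`;
    -- the multiplication formula then moves the transform back to `φ`.
    have key := congrArg (fun T => T G) (Lp.fourier_toTemperedDistribution_eq (h2.toLp φ))
    simp only [TemperedDistribution.fourier_apply, Lp.toTemperedDistribution_apply] at key
    have hG : ∀ x, G x = (g x : ℂ) := fun x => rfl
    have e1 : ∫ x, (𝓕 G : 𝓢(ℝ, ℂ)) x • (h2.toLp φ : ℝ → ℂ) x = ∫ x, (𝓕 (G : ℝ → ℂ)) x • φ x := by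
      apply integral_congr_ae
      filter_upwards [h2.coeFn_toLp] with x hx
      rw [hx, SchwartzMap.fourier_coe]
    have e2 : ∫ x, (𝓕 (G : ℝ → ℂ)) x • φ x = ∫ x, (G x) • (𝓕 φ) x := by
      have := VectorFourier.integral_fourierIntegral_smul_eq_flip (e := Real.fourierChar)
        (μ := volume) (ν := volume) (L := innerₗ ℝ) Real.continuous_fourierChar
        (by exact continuous_inner) G.integrable h1
      rw [flip_innerₗ] at this
      exact this
    rw [e1, e2] at key
    simp only [hG] at key
    simpa [Complex.real_smul] using key.symm

theorem memLp_fourier {φ : ℝ → ℂ} (h1 : Integrable φ) (h2 : MemLp φ 2) :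
    MemLp (𝓕 φ) 2 :=
  (Lp.memLp (𝓕 (h2.toLp φ) : Lp ℂ 2 (volume : Measure ℝ))).ae_eq (fourier_toLp_ae_eq h1 h2)

theorem integral_fourier_mul_conj {φ ψ : ℝ → ℂ} (h1 : Integrable φ) (h2 : MemLp φ 2)
    (k1 : Integrable ψ) (k2 : MemLp ψ 2) :
    ∫ x, 𝓕 φ x * conj (𝓕 ψ x) = ∫ x, φ x * conj (ψ x) := by
  have key := Lp.inner_fourier_eq (k2.toLp ψ) (h2.toLp φ)
  rw [L2.inner_def, L2.inner_def] at key
  have e1 : ∫ x, 𝓕 φ x * conj (𝓕 ψ x) = ∫ a, inner ℂ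
      ((𝓕 (k2.toLp ψ) : Lp ℂ 2 (volume : Measure ℝ)) a)
      ((𝓕 (h2.toLp φ) : Lp ℂ 2 (volume : Measure ℝ)) a) := by
    apply integral_congr_ae
    filter_upwards [fourier_toLp_ae_eq h1 h2, fourier_toLp_ae_eq k1 k2] with x hx hy
    rw [hx, hy]
    simp
  have e2 : ∫ x, φ x * conj (ψ x) = ∫ a, inner ℂ (k2.toLp ψ a) (h2.toLp φ a) := by
    apply integral_congr_ae
    filter_upwards [h2.coeFn_toLp, k2.coeFn_toLp] with x hx hy
    rw [hx, hy]
    simp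
  rw [e1, e2, key]

end Plancherel

/-! ### Paley–Wiener spaces, reproducing kernels and uniqueness sets. -/

/-- The function `z ↦ ∫_E φ(t) e^{itz} dt`. -/
noncomputable def pwTransform (E : Set ℝ) (φ : ℝ → ℂ) (z : ℂ) : ℂ :=
  ∫ t in E, φ t * Complex.exp (Complex.I * t * z)

theorem mem_paleyWiener_iff {E : Set ℝ} {f : ℂ → ℂ} :
    f ∈ paleyWiener E ↔ ∃ φ : ℝ → ℂ, MemLp φ 2 (volume.restrict E) ∧ f = pwTransform E φ := by
  simp only [paleyWiener, mem_ofPred_eq, funext_iff, pwTransform]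

section Compact
variable {E : Set ℝ} {φ ψ : ℝ → ℂ}

theorem integrableOn_of_memLp_two (hE : IsCompact E) (h : MemLp φ 2 (volume.restrict E)) :
    IntegrableOn φ E := by
  have : IsFiniteMeasure (volume.restrict E) := ⟨by simpa using hE.measure_lt_top⟩
  exact h.integrable (by norm_num)

theorem continuous_exp_I_mul (z : ℂ) : Continuous fun t : ℝ => Complex.exp (Complex.I * t * z) := by
  fun_prop

theorem integrableOn_mul_of_continuous (hE : IsCompact E) (h : IntegrableOn φ E)
    {g : ℝ → ℂ} (hg : Continuous g) : IntegrableOn (fun t => φ t * g t) E :=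
  h.mul_continuousOn hg.continuousOn hE

theorem memLp_mul_of_continuous (hE : IsCompact E) (h : MemLp φ 2 (volume.restrict E))
    {g : ℝ → ℂ} (hg : Continuous g) : MemLp (fun t => φ t * g t) 2 (volume.restrict E) := by
  obtain ⟨C, hC⟩ := hE.exists_bound_of_continuousOn hg.continuousOn
  refine h.of_le_mul (c := C) (h.1.mul hg.aestronglyMeasurable) ?_
  filter_upwards [ae_restrict_mem hE.measurableSet] with t ht
  rw [norm_mul, mul_comm]
  exact mul_le_mul_of_nonneg_right (hC t ht) (norm_nonneg _)

open scoped FourierTransform in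
-- The Mathlib transform has kernel `e^{-2πitξ}`, so `e^{itx}` corresponds to `ξ = -x/(2π)`.
theorem pwTransform_ofReal (hE : IsCompact E) (x : ℝ) :
    pwTransform E φ x = 𝓕 (E.indicator φ) (-(2 * Real.pi)⁻¹ * x) := by
  rw [Real.fourier_real_eq_integral_exp_smul, pwTransform, ← integral_indicator hE.measurableSet]
  congr 1
  ext t
  by_cases ht : t ∈ E
  · simp only [indicator_of_mem ht, smul_eq_mul]
    rw [mul_comm]
    congr 2
    have : (Real.pi : ℂ) ≠ 0 := by exact_mod_cast Real.pi_ne_zero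
    push_cast
    field_simp
  · simp [indicator_of_notMem ht]

theorem memLp_indicator (hE : IsCompact E) (h : MemLp φ 2 (volume.restrict E)) :
    MemLp (E.indicator φ) 2 :=
  (memLp_indicator_iff_restrict hE.measurableSet).2 h

theorem integrable_indicator_of_memLp (hE : IsCompact E) (h : MemLp φ 2 (volume.restrict E)) :
    Integrable (E.indicator φ) :=
  (integrable_indicator_iff hE.measurableSet).2 (integrableOn_of_memLp_two hE h)

theorem memLp_pwTransform (hE : IsCompact E) (h : MemLp φ 2 (volume.restrict E)) :
    MemLp (fun x : ℝ => pwTransform E φ x) 2 := by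
  have h2 := memLp_fourier (integrable_indicator_of_memLp hE h) (memLp_indicator hE h)
  simp_rw [pwTransform_ofReal hE]
  have hc : -(2 * Real.pi)⁻¹ ≠ 0 := by simp [Real.pi_ne_zero]
  have hm : Measure.map (fun x : ℝ => -(2 * Real.pi)⁻¹ * x) volume
      = ENNReal.ofReal |(-(2 * Real.pi)⁻¹)⁻¹| • volume := Real.map_volume_mul_left hc
  refine MemLp.comp_of_map (f := fun x : ℝ => -(2 * Real.pi)⁻¹ * x) ?_ (by fun_prop)
  rw [hm]
  exact h2.smul_measure ENNReal.ofReal_ne_top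

/-- Plancherel; the factor `2π` is the Jacobian of `x ↦ -x/(2π)`. -/
theorem pwInner_pwTransform (hE : IsCompact E) (h : MemLp φ 2 (volume.restrict E))
    (k : MemLp ψ 2 (volume.restrict E)) :
    pwInner (pwTransform E φ) (pwTransform E ψ) = 2 * Real.pi * ∫ t in E, φ t * conj (ψ t) := by
  have key := integral_fourier_mul_conj (integrable_indicator_of_memLp hE h) (memLp_indicator hE h)
    (integrable_indicator_of_memLp hE k) (memLp_indicator hE k)
  simp only [pwInner, pwTransform_ofReal hE]
  rw [Measure.integral_comp_mul_left (fun y => FourierTransform.fourier (E.indicator φ) y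
    * conj (FourierTransform.fourier (E.indicator ψ) y)), key, ← integral_indicator hE.measurableSet]
  have : |(-(2 * Real.pi)⁻¹)⁻¹| = 2 * Real.pi := by
    rw [inv_neg, inv_inv, abs_neg, abs_of_pos Real.two_pi_pos]
  rw [this, Complex.real_smul]
  push_cast
  congr 2
  ext t
  by_cases ht : t ∈ E <;> simp [ht]

theorem memLp_exp (hE : IsCompact E) (c w : ℂ) :
    MemLp (fun t : ℝ => c * Complex.exp (Complex.I * t * w)) 2 (volume.restrict E) := by
  have : IsFiniteMeasure (volume.restrict E) := ⟨by simpa using hE.measure_lt_top⟩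
  exact memLp_mul_of_continuous hE (memLp_const c) (continuous_exp_I_mul w)

theorem pwKernel_eq_pwTransform (w : ℂ) :
    pwKernel E w = pwTransform E
      (fun t => 1 / (2 * (Real.pi : ℂ)) * Complex.exp (Complex.I * t * (-conj w))) := by
  ext z
  simp only [pwKernel, pwTransform]
  rw [← integral_const_mul]
  congr 1
  ext t
  rw [mul_assoc (1 / (2 * (Real.pi : ℂ))), ← Complex.exp_add]
  congr 2
  ring

/-- The reproducing property of the kernels. -/
theorem pwInner_pwKernel (hE : IsCompact E) {g : ℂ → ℂ} (hg : g ∈ paleyWiener E) (w : ℂ) :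
    pwInner (pwKernel E w) g = conj (g w) := by
  obtain ⟨γ, hγ, rfl⟩ := mem_paleyWiener_iff.1 hg
  rw [pwKernel_eq_pwTransform, pwInner_pwTransform hE (memLp_exp hE _ _) hγ, pwTransform,
    ← integral_conj, ← integral_const_mul]
  congr 1
  ext t
  have : (Real.pi : ℂ) ≠ 0 := by exact_mod_cast Real.pi_ne_zero
  rw [map_mul, ← Complex.exp_conj]
  simp only [map_mul, Complex.conj_I, Complex.conj_ofReal]
  rw [show Complex.I * (t : ℂ) * -conj w = -Complex.I * t * conj w by ring]
  field_simp

theorem pwKernel_mem (hE : IsCompact E) (w : ℂ) : pwKernel E w ∈ paleyWiener E :=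
  mem_paleyWiener_iff.2 ⟨_, memLp_exp hE _ _, pwKernel_eq_pwTransform w⟩

theorem memLp_of_mem_paleyWiener (hE : IsCompact E) {g : ℂ → ℂ} (hg : g ∈ paleyWiener E) :
    MemLp (fun x : ℝ => g x) 2 := by
  obtain ⟨γ, hγ, rfl⟩ := mem_paleyWiener_iff.1 hg
  exact memLp_pwTransform hE hγ

theorem paleyWiener_add (hE : IsCompact E) {f g : ℂ → ℂ} (hf : f ∈ paleyWiener E)
    (hg : g ∈ paleyWiener E) : (fun z => f z + g z) ∈ paleyWiener E := by
  obtain ⟨φ, hφ, rfl⟩ := mem_paleyWiener_iff.1 hf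
  obtain ⟨γ, hγ, rfl⟩ := mem_paleyWiener_iff.1 hg
  refine ⟨_, hφ.add hγ, fun z => ?_⟩
  simp only [pwTransform]
  rw [← integral_add
    (integrableOn_mul_of_continuous hE (integrableOn_of_memLp_two hE hφ) (continuous_exp_I_mul z))
    (integrableOn_mul_of_continuous hE (integrableOn_of_memLp_two hE hγ) (continuous_exp_I_mul z))]
  simp [add_mul]

theorem paleyWiener_const_mul {f : ℂ → ℂ} (hf : f ∈ paleyWiener E) (c : ℂ) :
    (fun z => c * f z) ∈ paleyWiener E := by
  obtain ⟨φ, hφ, rfl⟩ := mem_paleyWiener_iff.1 hf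
  refine ⟨_, hφ.const_mul c, fun z => ?_⟩
  simp only [pwTransform]
  rw [← integral_const_mul]
  simp [mul_assoc]

theorem paleyWiener_sub (hE : IsCompact E) {f g : ℂ → ℂ} (hf : f ∈ paleyWiener E)
    (hg : g ∈ paleyWiener E) : (fun z => f z - g z) ∈ paleyWiener E := by
  simpa [sub_eq_add_neg] using paleyWiener_add hE hf (paleyWiener_const_mul hg (-1))

/-- Elements of `PW_E` are entire. -/
theorem differentiable_of_mem_paleyWiener (hE : IsCompact E) {f : ℂ → ℂ}
    (hf : f ∈ paleyWiener E) : Differentiable ℂ f := by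
  obtain ⟨φ, hφ, rfl⟩ := mem_paleyWiener_iff.1 hf
  intro z₀
  have hφ1 := integrableOn_of_memLp_two hE hφ
  obtain ⟨M, hM⟩ := hE.isBounded.exists_norm_le
  have := hasDerivAt_integral_of_dominated_loc_of_deriv_le (μ := volume.restrict E) (𝕜 := ℂ)
    (F := fun z t => φ t * Complex.exp (Complex.I * t * z))
    (F' := fun z t => φ t * (Complex.exp (Complex.I * t * z) * (Complex.I * t)))
    (bound := fun t => ‖φ t‖ * (Real.exp (M * (‖z₀‖ + 1)) * M))
    (x₀ := z₀) (s := Metric.ball z₀ 1) (Metric.ball_mem_nhds _ one_pos)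
    (Eventually.of_forall fun z =>
      (integrableOn_mul_of_continuous hE hφ1 (continuous_exp_I_mul z)).aestronglyMeasurable)
    (integrableOn_mul_of_continuous hE hφ1 (continuous_exp_I_mul z₀))
    (integrableOn_mul_of_continuous hE hφ1
      (g := fun t : ℝ => Complex.exp (Complex.I * t * z₀) * (Complex.I * t))
      (by fun_prop)).aestronglyMeasurable ?_ (hφ1.norm.mul_const _) ?_
  · exact this.2.differentiableAt
  · filter_upwards [ae_restrict_mem hE.measurableSet] with t ht z hz
    have h1 := hM t ht
    have hz' : ‖z‖ ≤ ‖z₀‖ + 1 := by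
      have := norm_sub_norm_le z z₀
      rw [mem_ball_iff_norm] at hz
      linarith
    have hn : ‖Complex.I * (t : ℂ)‖ ≤ M := by simpa using h1
    have hM0 : 0 ≤ M := (norm_nonneg _).trans hn
    rw [norm_mul, norm_mul]
    gcongr
    rw [Complex.norm_exp]
    apply Real.exp_le_exp.2
    refine (Complex.re_le_norm _).trans ?_
    rw [norm_mul]
    gcongr
  · refine Eventually.of_forall fun t z _ => ?_
    have : HasDerivAt (fun z : ℂ => Complex.I * t * z) (Complex.I * t) z := by
      simpa using (hasDerivAt_id z).const_mul (Complex.I * (t : ℂ))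
    exact (this.cexp).const_mul _

theorem pwInner_span_eq_zero {g : ℂ → ℂ} {s : Set (ℂ → ℂ)}
    (hg : MemLp (fun x : ℝ => g x) 2)
    (hs : ∀ k ∈ s, MemLp (fun x : ℝ => k x) 2 ∧ pwInner k g = 0) {p : ℂ → ℂ}
    (hp : p ∈ Submodule.span ℂ s) : MemLp (fun x : ℝ => p x) 2 ∧ pwInner p g = 0 := by
  have hint : ∀ {q : ℂ → ℂ}, MemLp (fun x : ℝ => q x) 2 →
      Integrable (fun x : ℝ => q x * conj (g x)) := fun hq =>
    hq.integrable_mul (p := 2) (q := 2) hg.star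
  induction hp using Submodule.span_induction with
  | mem x hx => exact hs x hx
  | zero => exact ⟨by simp, by simp [pwInner]⟩
  | add x y _ _ hx hy =>
    refine ⟨hx.1.add hy.1, ?_⟩
    have := integral_add (hint hx.1) (hint hy.1)
    simp only [pwInner] at hx hy ⊢
    simp only [Pi.add_apply, add_mul, this, hx.2, hy.2, add_zero]
  | smul c x _ hx =>
    refine ⟨hx.1.const_smul c, ?_⟩
    simp only [pwInner] at hx ⊢
    simp only [Pi.smul_apply, smul_eq_mul, mul_assoc, integral_const_mul, hx.2, mul_zero]

/-- A function in the closed span of `s` and orthogonal to `s` vanishes almost everywhere. -/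
theorem ae_eq_zero_of_inClosedSpan {g : ℂ → ℂ} {s : Set (ℂ → ℂ)}
    (hg : MemLp (fun x : ℝ => g x) 2)
    (hs : ∀ k ∈ s, MemLp (fun x : ℝ => k x) 2 ∧ pwInner k g = 0) (hc : InClosedSpan s g) :
    (fun x : ℝ => g x) =ᵐ[volume] 0 := by
  rw [← MemLp.toLp_eq_toLp_iff hg MemLp.zero, MemLp.toLp_zero]
  rw [← norm_le_zero_iff]
  refine le_of_forall_pos_le_add fun ε hε => ?_
  obtain ⟨p, hp, hpe⟩ := hc (ENNReal.ofReal ε) (by simpa using hε)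
  obtain ⟨hp2, hp0⟩ := pwInner_span_eq_zero hg hs hp
  rw [zero_add]
  set G := hg.toLp (fun x : ℝ => g x)
  set P := hp2.toLp (fun x : ℝ => p x)
  have hdist : ‖G - P‖ ≤ ε := by
    rw [← MemLp.toLp_sub, Lp.norm_toLp]
    exact ENNReal.toReal_le_of_le_ofReal hε.le hpe.le
  have horth : inner ℂ G P = 0 := by
    rw [L2.inner_def, ← hp0, pwInner]
    apply integral_congr_ae
    filter_upwards [hg.coeFn_toLp, hp2.coeFn_toLp] with x hx hy
    rw [hx, hy]
    simp
  -- As `P ⊥ G`, `⟨G, G⟩ = ⟨G, G - P⟩`, and Cauchy–Schwarz applies.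
  have h1 : ‖G‖ * ‖G‖ ≤ ‖G‖ * ε := by
    have e : inner ℂ G G = inner ℂ G (G - P) := by rw [inner_sub_right, horth, sub_zero]
    have e2 : ‖inner ℂ G G‖ = ‖G‖ * ‖G‖ := by
      rw [inner_self_eq_norm_sq_to_K]; simp [sq]
    rw [← e2, e]
    exact (norm_inner_le_norm _ _).trans (by gcongr)
  by_contra h
  push Not at h
  nlinarith [norm_nonneg G]

/-- If the kernels are complete, then `Λ` is a uniqueness set for `PW_E`. -/
theorem eq_zero_of_kernelsComplete (hE : IsCompact E) {Λ : Set ℂ} (hΛ : KernelsComplete E Λ)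
    {g : ℂ → ℂ} (hg : g ∈ paleyWiener E) (h0 : ∀ l ∈ Λ, g l = 0) : ∀ z, g z = 0 := by
  have hae := ae_eq_zero_of_inClosedSpan (memLp_of_mem_paleyWiener hE hg) (s := pwKernel E '' Λ)
    (by
      rintro _ ⟨w, hw, rfl⟩
      refine ⟨memLp_of_mem_paleyWiener hE (pwKernel_mem hE w), ?_⟩
      rw [pwInner_pwKernel hE hg, h0 w hw, map_zero]) (hΛ g hg)
  -- Continuity upgrades vanishing almost everywhere to vanishing on all of `ℝ`, and the identity
  -- theorem does the rest.
  have hd := differentiable_of_mem_paleyWiener hE hg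
  have hR : (fun x : ℝ => g x) = 0 :=
    (Continuous.ae_eq_iff_eq volume (hd.continuous.comp Complex.continuous_ofReal)
      continuous_const).1 hae
  have han : AnalyticOnNhd ℂ g univ := hd.differentiableOn.analyticOnNhd isOpen_univ
  have hfreq : ∃ᶠ z in nhdsWithin (0 : ℂ) {0}ᶜ, g z = 0 := by
    have ht : Tendsto (fun x : ℝ => (x : ℂ)) (nhdsWithin 0 {0}ᶜ) (nhdsWithin (0 : ℂ) {0}ᶜ) := by
      refine tendsto_nhdsWithin_iff.2 ⟨?_, ?_⟩
      · exact (Complex.continuous_ofReal.tendsto' 0 0 (by simp)).mono_left nhdsWithin_le_nhds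
      · filter_upwards [self_mem_nhdsWithin] with x hx
        simpa using hx
    exact ht.frequently (Eventually.frequently (Eventually.of_forall fun x => congrFun hR x))
  intro z
  exact han.eqOn_zero_of_preconnected_of_frequently_eq_zero isPreconnected_univ (mem_univ 0) hfreq
    (mem_univ z)

end Compact

/-! ### Division by zeros, and growth bounds. -/

section Division
variable {a b : ℝ}

/-- The factor `α` is kept on the left so that `α = 0` is covered. -/
theorem integral_Icc_indicator_exp {s : ℝ} (hs : s ∈ Icc a b) (α : ℂ) :
    α * ∫ t in Icc a b, (if s ≤ t then Complex.exp (α * t) else 0)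
      = Complex.exp (α * b) - Complex.exp (α * s) := by
  have h1 : ∫ t in Icc a b, (if s ≤ t then Complex.exp (α * t) else 0)
      = ∫ t in s..b, Complex.exp (α * t) := by
    rw [intervalIntegral.integral_of_le hs.2, ← integral_Icc_eq_integral_Ioc,
      ← integral_indicator measurableSet_Icc, ← integral_indicator measurableSet_Icc]
    congr 1
    ext t
    simp only [indicator, mem_Icc]
    have := hs.1
    split_ifs <;> first | rfl | (exfalso; grind)
  rw [h1]
  rcases eq_or_ne α 0 with rfl | hα
  · simp
  · rw [integral_exp_mul_complex hα]
    field_simp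

/-- An element of `PW_I`, where `I` is a compact interval, can be divided by its zeros. -/
theorem exists_mul_sub_of_mem_paleyWiener {u : ℂ → ℂ} (hu : u ∈ paleyWiener (Icc a b)) {μ : ℂ}
    (h0 : u μ = 0) : ∃ v ∈ paleyWiener (Icc a b), ∀ z, u z = (z - μ) * v z := by
  obtain ⟨φ, hφ, rfl⟩ := mem_paleyWiener_iff.1 hu
  have hE : IsCompact (Icc a b) := isCompact_Icc
  have : IsFiniteMeasure (volume.restrict (Icc a b)) := ⟨by simp⟩
  set g : ℝ → ℂ := fun s => φ s * Complex.exp (Complex.I * s * μ)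
  have hg : IntegrableOn g (Icc a b) :=
    integrableOn_mul_of_continuous hE (integrableOn_of_memLp_two hE hφ) (continuous_exp_I_mul μ)
  have hms : MeasurableSet {p : ℝ × ℝ | p.2 ≤ p.1} := measurableSet_le measurable_snd measurable_fst
  -- This licenses Fubini below; the case `α = 0` also gives the measurability of `Φ`.
  have hK : ∀ α : ℂ, Integrable (fun p : ℝ × ℝ => if p.2 ≤ p.1 then
      Complex.exp (α * p.1) * g p.2 else 0)
      ((volume.restrict (Icc a b)).prod (volume.restrict (Icc a b))) := by
    intro α
    have h1 : IntegrableOn (fun t : ℝ => Complex.exp (α * t)) (Icc a b) :=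
      (Continuous.continuousOn (by fun_prop)).integrableOn_compact hE
    have := (h1.mul_prod hg).indicator hms
    refine this.congr (Eventually.of_forall fun p => ?_)
    simp [indicator]
  -- `Φ` is the primitive of `φ(s)e^{isμ}`, and it vanishes at both endpoints because `u(μ) = 0`.
  -- Integration by parts, carried out through Fubini, shows that `-iΦ(t)e^{-itμ}` has transform
  -- `u(z)/(z - μ)`.
  set Φ : ℝ → ℂ := fun t => ∫ s in Icc a b, if s ≤ t then g s else 0
  have hΦm : AEStronglyMeasurable Φ (volume.restrict (Icc a b)) := by
    have := (hK 0).aestronglyMeasurable.integral_prod_right'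
    simpa using this
  have hΦ : MemLp Φ 2 (volume.restrict (Icc a b)) := by
    refine MemLp.of_bound hΦm (∫ s in Icc a b, ‖g s‖) (Eventually.of_forall fun t => ?_)
    refine norm_integral_le_of_norm_le hg.norm (Eventually.of_forall fun s => ?_)
    split_ifs <;> simp
  have hψ : MemLp (fun t : ℝ => Φ t * (-Complex.I * Complex.exp (-(Complex.I * t * μ)))) 2
      (volume.restrict (Icc a b)) := memLp_mul_of_continuous hE hΦ (by fun_prop)
  refine ⟨_, mem_paleyWiener_iff.2 ⟨_, hψ, rfl⟩, fun z => ?_⟩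
  set α : ℂ := Complex.I * (z - μ) with hα
  have e1 : ∫ t in Icc a b, Φ t * (-Complex.I * Complex.exp (-(Complex.I * t * μ)))
      * Complex.exp (Complex.I * t * z) = -Complex.I * ∫ t in Icc a b, ∫ s in Icc a b,
        if s ≤ t then Complex.exp (α * t) * g s else 0 := by
    rw [← integral_const_mul]
    congr 1
    ext t
    have : ∀ s, (if s ≤ t then Complex.exp (α * t) * g s else 0)
        = Complex.exp (α * t) * (if s ≤ t then g s else 0) := fun s => by split_ifs <;> simp
    simp only [this, integral_const_mul]
    rw [show α * t = -(Complex.I * t * μ) + Complex.I * t * z by rw [hα]; ring, Complex.exp_add]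
    ring
  have e2 : α * ∫ t in Icc a b, ∫ s in Icc a b, (if s ≤ t then Complex.exp (α * t) * g s else 0)
      = - pwTransform (Icc a b) φ z := by
    rw [integral_integral_swap (hK α), ← integral_const_mul]
    have e3 : ∫ s in Icc a b, α * ∫ t in Icc a b, (if s ≤ t then Complex.exp (α * t) * g s else 0)
        = ∫ s in Icc a b, (g s * Complex.exp (α * b) - φ s * Complex.exp (Complex.I * s * z)) := by
      apply setIntegral_congr_fun measurableSet_Icc
      intro s hs
      have : ∀ t : ℝ, (if s ≤ t then Complex.exp (α * t) * g s else 0)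
          = (if s ≤ t then Complex.exp (α * t) else 0) * g s := fun s => by split_ifs <;> simp
      simp only [this, integral_mul_const]
      rw [← mul_assoc, integral_Icc_indicator_exp hs, sub_mul,
        show Complex.I * s * z = Complex.I * s * μ + α * s by rw [hα]; ring, Complex.exp_add]
      simp only [g]
      ring
    rw [e3, integral_sub (hg.mul_const _) (integrableOn_mul_of_continuous hE
      (integrableOn_of_memLp_two hE hφ) (continuous_exp_I_mul z)), integral_mul_const]
    -- The boundary term at `b` is a multiple of `u(μ)`.
    have : ∫ s in Icc a b, g s = 0 := h0
    rw [this, zero_mul, zero_sub, pwTransform]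
  have e4 : pwTransform (Icc a b) (fun t : ℝ => Φ t * (-Complex.I * Complex.exp
      (-(Complex.I * t * μ)))) z = -Complex.I * ∫ t in Icc a b, ∫ s in Icc a b,
        if s ≤ t then Complex.exp (α * t) * g s else 0 := e1
  rw [e4]
  linear_combination e2

/-- An element of `PW_I + z PW_I` that vanishes at `μ` is a multiple of `z - μ` in `PW_I`. -/
theorem exists_mul_sub_of_mem_paleyWienerAddZ {f : ℂ → ℂ} (hf : f ∈ paleyWienerAddZ (Icc a b))
    {μ : ℂ} (h0 : f μ = 0) : ∃ v ∈ paleyWiener (Icc a b), ∀ z, f z = (z - μ) * v z := by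
  obtain ⟨u, hu, v, hv, h⟩ := hf
  -- `u + zv = (u + μv) + (z - μ)v`, so it is enough to divide `u + μv`.
  have hw := paleyWiener_add isCompact_Icc hu (paleyWiener_const_mul hv μ)
  obtain ⟨w, hw, hwz⟩ := exists_mul_sub_of_mem_paleyWiener hw (μ := μ) (by rw [← h, h0])
  refine ⟨_, paleyWiener_add isCompact_Icc hw hv, fun z => ?_⟩
  rw [h]
  linear_combination hwz z

theorem paleyWienerAddZ_comb {I : Set ℝ} (hI : IsCompact I) {f g : ℂ → ℂ}
    (hf : f ∈ paleyWienerAddZ I) (hg : g ∈ paleyWienerAddZ I) (α β : ℂ) :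
    (fun z => α * f z + β * g z) ∈ paleyWienerAddZ I := by
  obtain ⟨u, hu, v, hv, h⟩ := hf
  obtain ⟨u', hu', v', hv', h'⟩ := hg
  refine ⟨_, paleyWiener_add hI (paleyWiener_const_mul hu α) (paleyWiener_const_mul hu' β),
    _, paleyWiener_add hI (paleyWiener_const_mul hv α) (paleyWiener_const_mul hv' β), fun z => ?_⟩
  simp only [h, h']
  ring

theorem differentiable_of_mem_paleyWienerAddZ {I : Set ℝ} (hI : IsCompact I) {f : ℂ → ℂ}
    (hf : f ∈ paleyWienerAddZ I) : Differentiable ℂ f := by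
  obtain ⟨u, hu, v, hv, h⟩ := hf
  rw [funext h]
  exact (differentiable_of_mem_paleyWiener hI hu).add
    (differentiable_id.mul (differentiable_of_mem_paleyWiener hI hv))

/-- The sum of elements of `PW_I` and `PW_J` is in `PW_{I ∪ J}`. -/
theorem add_mem_paleyWiener_union {I J : Set ℝ} (hI : IsCompact I) (hJ : IsCompact J)
    {u v : ℂ → ℂ} (hu : u ∈ paleyWiener I) (hv : v ∈ paleyWiener J) :
    (fun z => u z + v z) ∈ paleyWiener (I ∪ J) := by
  obtain ⟨φ, hφ, rfl⟩ := mem_paleyWiener_iff.1 hu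
  obtain ⟨γ, hγ, rfl⟩ := mem_paleyWiener_iff.1 hv
  have h1 := memLp_indicator hI hφ
  have h2 := memLp_indicator hJ hγ
  refine ⟨_, (h1.add h2).restrict (I ∪ J), fun z => ?_⟩
  have e : ∀ t, (I.indicator φ + J.indicator γ) t * Complex.exp (Complex.I * t * z)
      = I.indicator (fun t => φ t * Complex.exp (Complex.I * t * z)) t
        + J.indicator (fun t => γ t * Complex.exp (Complex.I * t * z)) t := by
    intro t
    simp only [Pi.add_apply, add_mul, indicator]
    split_ifs <;> simp
  have i1 := integrableOn_mul_of_continuous hI (integrableOn_of_memLp_two hI hφ)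
    (continuous_exp_I_mul z)
  have i2 := integrableOn_mul_of_continuous hJ (integrableOn_of_memLp_two hJ hγ)
    (continuous_exp_I_mul z)
  simp only [e]
  rw [integral_add ((integrable_indicator_iff hI.measurableSet).2 i1).integrableOn
    ((integrable_indicator_iff hJ.measurableSet).2 i2).integrableOn,
    setIntegral_indicator hI.measurableSet, setIntegral_indicator hJ.measurableSet,
    inter_eq_self_of_subset_right subset_union_left,
    inter_eq_self_of_subset_right subset_union_right]
  rfl

/-- `|e^{itz}| = e^{-t Im z}` is largest at `t = a` in the upper half-plane and at `t = b` in the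
lower one. -/
theorem norm_le_of_mem_paleyWiener {u : ℂ → ℂ} (hu : u ∈ paleyWiener (Icc a b)) :
    ∃ C, 0 ≤ C ∧ (∀ z : ℂ, 0 ≤ z.im → ‖u z‖ ≤ C * Real.exp (-a * z.im)) ∧
      (∀ z : ℂ, z.im ≤ 0 → ‖u z‖ ≤ C * Real.exp (-b * z.im)) := by
  obtain ⟨φ, hφ, rfl⟩ := mem_paleyWiener_iff.1 hu
  have hφ1 := integrableOn_of_memLp_two isCompact_Icc hφ
  have key : ∀ (z : ℂ) (M : ℝ), (∀ t ∈ Icc a b, -t * z.im ≤ M) →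
      ‖pwTransform (Icc a b) φ z‖ ≤ (∫ t in Icc a b, ‖φ t‖) * Real.exp M := by
    intro z M hM
    rw [← integral_mul_const]
    refine norm_integral_le_of_norm_le (hφ1.norm.mul_const _) ?_
    filter_upwards [ae_restrict_mem measurableSet_Icc] with t ht
    rw [norm_mul, Complex.norm_exp]
    gcongr
    simpa using hM t ht
  refine ⟨∫ t in Icc a b, ‖φ t‖, integral_nonneg fun _ => norm_nonneg _, fun z hz => ?_,
    fun z hz => ?_⟩
  · exact key z _ fun t ht => by nlinarith [ht.1]
  · exact key z _ fun t ht => by nlinarith [ht.2]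

theorem norm_le_of_mem_paleyWienerAddZ {f : ℂ → ℂ} (hf : f ∈ paleyWienerAddZ (Icc a b)) :
    ∃ C, 0 ≤ C ∧ (∀ z : ℂ, 0 ≤ z.im → ‖f z‖ ≤ C * (1 + ‖z‖) * Real.exp (-a * z.im)) ∧
      (∀ z : ℂ, z.im ≤ 0 → ‖f z‖ ≤ C * (1 + ‖z‖) * Real.exp (-b * z.im)) := by
  obtain ⟨u, hu, v, hv, h⟩ := hf
  obtain ⟨C, hC, h1, h2⟩ := norm_le_of_mem_paleyWiener hu
  obtain ⟨D, hD, k1, k2⟩ := norm_le_of_mem_paleyWiener hv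
  have key : ∀ (z : ℂ) (X : ℝ), 0 ≤ X → ‖u z‖ ≤ C * X → ‖v z‖ ≤ D * X →
      ‖f z‖ ≤ (C + D) * (1 + ‖z‖) * X := by
    intro z X hX hu hv
    rw [h]
    have h1 : ‖u z + z * v z‖ ≤ C * X + ‖z‖ * (D * X) := by
      refine (norm_add_le _ _).trans (add_le_add hu ?_)
      rw [norm_mul]
      gcongr
    have := mul_nonneg hD hX
    have := mul_nonneg (mul_nonneg (norm_nonneg z) hC) hX
    linarith
  exact ⟨C + D, by positivity, fun z hz => key z _ (Real.exp_pos _).le (h1 z hz) (k1 z hz),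
    fun z hz => key z _ (Real.exp_pos _).le (h2 z hz) (k2 z hz)⟩

end Division

/-! ### The generating function `S` and its zeros. -/

section GeneratingFunction
variable {a₁ b₁ a₂ b₂ : ℝ} {Λ : Set ℂ} {F₁ F₂ F₁₁ F₁₂ F₂₁ F₂₂ S : ℂ → ℂ}

/-- A combination of `F₁`, `F₂` whose first component vanishes at a common zero of `F₁`, `F₂`
is divisible by `z - l` in `PW_E`. -/
theorem exists_mul_sub_of_components
    {G₁ G₂ : ℂ → ℂ} (h₁ : G₁ ∈ paleyWienerAddZ (Icc a₁ b₁)) (h₂ : G₂ ∈ paleyWienerAddZ (Icc a₂ b₂))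
    {μ : ℂ} (h₁0 : G₁ μ = 0) (h₂0 : G₂ μ = 0) :
    ∃ v ∈ paleyWiener (Icc a₁ b₁ ∪ Icc a₂ b₂), ∀ z, G₁ z + G₂ z = (z - μ) * v z := by
  obtain ⟨u, hu, hu'⟩ := exists_mul_sub_of_mem_paleyWienerAddZ h₁ h₁0
  obtain ⟨v, hv, hv'⟩ := exists_mul_sub_of_mem_paleyWienerAddZ h₂ h₂0
  refine ⟨_, add_mem_paleyWiener_union isCompact_Icc isCompact_Icc hu hv, fun z => ?_⟩
  rw [hu', hv']
  ring

theorem pair_combination_ne_zero (hind : LinearIndependent ℂ ![F₁, F₂]) {α β : ℂ}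
    (h : ∀ z, α * F₁ z + β * F₂ z = 0) : α = 0 ∧ β = 0 :=
  LinearIndependent.pair_iff.1 hind α β (funext fun z => by simpa using h z)

variable (hE : KernelsComplete (Icc a₁ b₁ ∪ Icc a₂ b₂) Λ)
  (hind : LinearIndependent ℂ ![F₁, F₂])
  (hF₁₁ : F₁₁ ∈ paleyWienerAddZ (Icc a₁ b₁)) (hF₂₁ : F₂₁ ∈ paleyWienerAddZ (Icc a₁ b₁))
  (hF₁₂ : F₁₂ ∈ paleyWienerAddZ (Icc a₂ b₂)) (hF₂₂ : F₂₂ ∈ paleyWienerAddZ (Icc a₂ b₂))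
  (hdec₁ : ∀ z : ℂ, F₁ z = F₁₁ z + F₁₂ z) (hdec₂ : ∀ z : ℂ, F₂ z = F₂₁ z + F₂₂ z)
  (h1 : ∀ l ∈ Λ, F₁ l = 0) (h2 : ∀ l ∈ Λ, F₂ l = 0)
  (hS : ∀ z : ℂ, S z = F₁₁ z * F₂₂ z - F₁₂ z * F₂₁ z)

include hF₁₁ hF₂₁ hF₁₂ hF₂₂ hdec₁ hdec₂ in
/-- A combination of `F₁`, `F₂` both of whose components vanish at `μ` is `z - μ` times an element
of `PW_E`. -/
theorem exists_mul_sub_of_combination {α β μ : ℂ} (e1 : α * F₁₁ μ + β * F₂₁ μ = 0)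
    (e2 : α * F₁₂ μ + β * F₂₂ μ = 0) :
    ∃ v ∈ paleyWiener (Icc a₁ b₁ ∪ Icc a₂ b₂), ∀ z, α * F₁ z + β * F₂ z = (z - μ) * v z := by
  obtain ⟨v, hv, h⟩ := exists_mul_sub_of_components
    (paleyWienerAddZ_comb isCompact_Icc hF₁₁ hF₂₁ α β)
    (paleyWienerAddZ_comb isCompact_Icc hF₁₂ hF₂₂ α β) e1 e2
  refine ⟨v, hv, fun z => ?_⟩
  rw [← h, hdec₁, hdec₂]
  ring

theorem isCompact_union_Icc : IsCompact (Icc a₁ b₁ ∪ Icc a₂ b₂) :=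
  isCompact_Icc.union isCompact_Icc

include hE hind hF₁₁ hF₂₁ hF₁₂ hF₂₂ hdec₁ hdec₂ h1 h2 in
-- The uniqueness principle behind parts 1 and 2. The quotient by `z - μ` vanishes on `Λ \ {μ}`, and
-- `hμ` takes care of the point `μ` when it lies in `Λ`.
theorem eq_zero_of_combination {α β μ : ℂ} (e1 : α * F₁₁ μ + β * F₂₁ μ = 0)
    (e2 : α * F₁₂ μ + β * F₂₂ μ = 0) (hμ : μ ∈ Λ → ∀ v : ℂ → ℂ,
      v ∈ paleyWiener (Icc a₁ b₁ ∪ Icc a₂ b₂) →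
      (∀ z, α * F₁ z + β * F₂ z = (z - μ) * v z) → v μ = 0) : α = 0 ∧ β = 0 := by
  obtain ⟨v, hv, h⟩ := exists_mul_sub_of_combination hF₁₁ hF₂₁ hF₁₂ hF₂₂ hdec₁ hdec₂ e1 e2
  have hv0 : ∀ z, v z = 0 := by
    refine eq_zero_of_kernelsComplete isCompact_union_Icc hE hv fun l hl => ?_
    rcases eq_or_ne l μ with rfl | hne
    · exact hμ hl v hv h
    · have := h l
      rw [h1 l hl, h2 l hl] at this
      simpa [sub_ne_zero.2 hne] using this.symm
  exact pair_combination_ne_zero hind fun z => by rw [h, hv0, mul_zero]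

include hE hind hF₁₁ hF₂₁ hF₁₂ hF₂₂ hdec₁ hdec₂ h1 h2 in
/-- The first components of `F₁`, `F₂` have no common zero in `Λ`. -/
theorem not_components_eq_zero {l : ℂ} (hl : l ∈ Λ) : ¬ (F₁₁ l = 0 ∧ F₂₁ l = 0) := by
  rintro ⟨p, q⟩
  have p' : F₁₂ l = 0 := by simpa [p, h1 l hl] using (hdec₁ l).symm
  have q' : F₂₂ l = 0 := by simpa [q, h2 l hl] using (hdec₂ l).symm
  obtain ⟨u, hu, hu'⟩ := exists_mul_sub_of_combination hF₁₁ hF₂₁ hF₁₂ hF₂₂ hdec₁ hdec₂ (α := 1)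
    (β := 0) (μ := l) (by simp [p]) (by simp [p'])
  obtain ⟨v, hv, hv'⟩ := exists_mul_sub_of_combination hF₁₁ hF₂₁ hF₁₂ hF₂₂ hdec₁ hdec₂ (α := 0)
    (β := 1) (μ := l) (by simp [q]) (by simp [q'])
  have hdiff : ∀ w ∈ paleyWiener (Icc a₁ b₁ ∪ Icc a₂ b₂), ContinuousAt w l := fun w hw =>
    (differentiable_of_mem_paleyWiener isCompact_union_Icc hw).continuous.continuousAt
  -- These coefficients make the quotient `v(l)u - u(l)v`, which vanishes at `l`. Hence `u(l) = 0`,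
  -- and then `F₁ = (z - l)u` alone contradicts the uniqueness principle.
  have key := eq_zero_of_combination hE hind hF₁₁ hF₂₁ hF₁₂ hF₂₂ hdec₁ hdec₂ h1 h2
    (α := v l) (β := -u l) (μ := l) (by simp [p, q]) (by simp [p', q']) ?_
  · have hul : u l = 0 := by simpa using key.2
    have := eq_zero_of_combination hE hind hF₁₁ hF₂₁ hF₁₂ hF₂₂ hdec₁ hdec₂ h1 h2
      (α := 1) (β := 0) (μ := l) (by simp [p]) (by simp [p']) ?_
    · simpa using this.1
    · intro _ w hw hw'
      rw [← hul]
      have : w =ᶠ[nhdsWithin l {l}ᶜ] u := by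
        filter_upwards [self_mem_nhdsWithin] with z hz
        have := hw' z
        rw [hu'] at this
        exact (mul_left_cancel₀ (sub_ne_zero.2 hz) this).symm
      exact tendsto_nhds_unique_of_eventuallyEq ((hdiff w hw).mono_left nhdsWithin_le_nhds)
        ((hdiff u hu).mono_left nhdsWithin_le_nhds) this
  · intro _ w hw hw'
    have : w =ᶠ[nhdsWithin l {l}ᶜ] fun z => v l * u z - u l * v z := by
      filter_upwards [self_mem_nhdsWithin] with z hz
      refine mul_left_cancel₀ (sub_ne_zero.2 hz) ?_
      rw [← hw' z]
      linear_combination v l * hu' z - u l * hv' z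
    have := tendsto_nhds_unique_of_eventuallyEq ((hdiff w hw).mono_left nhdsWithin_le_nhds)
      ((((hdiff u hu).const_mul _).sub ((hdiff v hv).const_mul _)).mono_left nhdsWithin_le_nhds)
      this
    rw [this]
    simp [mul_comm]

include hE hind hF₁₁ hF₂₁ hF₁₂ hF₂₂ hdec₁ hdec₂ h1 h2 in
-- Since `F_k(l) = 0`, the second components at `l` are the negatives of the first, so the vector
-- that annihilates the first components annihilates the second too. If `v(l) = 0`, the uniqueness
-- principle would make both first components vanish at `l`.
theorem exists_generator {l : ℂ} (hl : l ∈ Λ) :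
    ∃ v ∈ paleyWiener (Icc a₁ b₁ ∪ Icc a₂ b₂),
      (∀ z, F₁₁ l * F₂ z - F₂₁ l * F₁ z = (z - l) * v z) ∧ v l ≠ 0 := by
  have p' : F₁₂ l = -F₁₁ l := by
    have := hdec₁ l
    rw [h1 l hl] at this
    linear_combination -this
  have q' : F₂₂ l = -F₂₁ l := by
    have := hdec₂ l
    rw [h2 l hl] at this
    linear_combination -this
  have e1 : -F₂₁ l * F₁₁ l + F₁₁ l * F₂₁ l = 0 := by ring
  have e2 : -F₂₁ l * F₁₂ l + F₁₁ l * F₂₂ l = 0 := by rw [p', q']; ring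
  obtain ⟨v, hv, h⟩ := exists_mul_sub_of_combination hF₁₁ hF₂₁ hF₁₂ hF₂₂ hdec₁ hdec₂ e1 e2
  refine ⟨v, hv, fun z => by rw [← h]; ring, fun hv0 => ?_⟩
  refine not_components_eq_zero hE hind hF₁₁ hF₂₁ hF₁₂ hF₂₂ hdec₁ hdec₂ h1 h2 hl ?_
  have := eq_zero_of_combination hE hind hF₁₁ hF₂₁ hF₁₂ hF₂₂ hdec₁ hdec₂ h1 h2 e1 e2 ?_
  · exact ⟨this.2, by simpa using this.1⟩
  · intro _ w hw hw'
    rw [← hv0]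
    have : w =ᶠ[nhdsWithin l {l}ᶜ] v := by
      filter_upwards [self_mem_nhdsWithin] with z hz
      refine mul_left_cancel₀ (sub_ne_zero.2 hz) ?_
      rw [← hw', h]
    exact tendsto_nhds_unique_of_eventuallyEq
      ((differentiable_of_mem_paleyWiener isCompact_union_Icc hw).continuous.continuousAt.mono_left
        nhdsWithin_le_nhds)
      ((differentiable_of_mem_paleyWiener isCompact_union_Icc hv).continuous.continuousAt.mono_left
        nhdsWithin_le_nhds) this

include hdec₁ hdec₂ hS in
theorem generatingFunction_eq (z : ℂ) : S z = F₁₁ z * F₂ z - F₂₁ z * F₁ z := by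
  rw [hS, hdec₁, hdec₂]
  ring

include hF₁₁ hF₂₁ hF₁₂ hF₂₂ hS in
theorem differentiable_generatingFunction : Differentiable ℂ S := by
  rw [funext hS]
  have d := fun (f : ℂ → ℂ) (a b : ℝ) (h : f ∈ paleyWienerAddZ (Icc a b)) =>
    differentiable_of_mem_paleyWienerAddZ isCompact_Icc h
  exact ((d _ _ _ hF₁₁).mul (d _ _ _ hF₂₂)).sub ((d _ _ _ hF₁₂).mul (d _ _ _ hF₂₁))

include hE hind hF₁₁ hF₂₁ hF₁₂ hF₂₂ hdec₁ hdec₂ h1 h2 hS in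
theorem generatingFunction_eq_zero_iff (z : ℂ) : S z = 0 ↔ z ∈ Λ := by
  constructor
  · intro hz
    by_contra hzΛ
    rw [hS] at hz
    have k : ∀ α β : ℂ, α * F₁₁ z + β * F₂₁ z = 0 → α * F₁₂ z + β * F₂₂ z = 0 → α = 0 ∧ β = 0 :=
      fun α β e1 e2 => eq_zero_of_combination hE hind hF₁₁ hF₂₁ hF₁₂ hF₂₂ hdec₁ hdec₂ h1 h2 e1 e2
        fun h => absurd h hzΛ
    -- When the determinant is zero, `(F₂₁, -F₁₁)` and `(F₂₂, -F₁₂)` annihilate both columns, so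
    -- these entries vanish. Then `(1, 0)` annihilates both columns as well, which is absurd.
    have k1 := k (F₂₁ z) (-F₁₁ z) (by ring) (by linear_combination -hz)
    have k2 := k (F₂₂ z) (-F₁₂ z) (by linear_combination hz) (by ring)
    have k3 := k 1 0 (by simpa using k1.2) (by simpa using k2.2)
    simpa using k3.1
  · intro hz
    rw [generatingFunction_eq hdec₁ hdec₂ hS, h1 z hz, h2 z hz]
    ring

include hE hind hF₁₁ hF₂₁ hF₁₂ hF₂₂ hdec₁ hdec₂ h1 h2 hS in
-- Because `F_k(l) = 0`, differentiating `S = F₁₁F₂ - F₂₁F₁` at `l` gives the same value as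
-- differentiating `F₁₁(l)F₂ - F₂₁(l)F₁ = (z - l)v`, namely `v(l) ≠ 0`.
theorem analyticOrderAt_generatingFunction {l : ℂ} (hl : l ∈ Λ) : analyticOrderAt S l = 1 := by
  have hSd := differentiable_generatingFunction hF₁₁ hF₂₁ hF₁₂ hF₂₂ hS
  obtain ⟨v, hv, h, hv0⟩ :=
    exists_generator hE hind hF₁₁ hF₂₁ hF₁₂ hF₂₂ hdec₁ hdec₂ h1 h2 hl
  have d := fun (f : ℂ → ℂ) (a b : ℝ) (h : f ∈ paleyWienerAddZ (Icc a b)) =>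
    (differentiable_of_mem_paleyWienerAddZ isCompact_Icc h l).hasDerivAt
  have d1 : HasDerivAt F₁ (deriv F₁₁ l + deriv F₁₂ l) l := by
    rw [funext hdec₁]
    exact (d _ _ _ hF₁₁).add (d _ _ _ hF₁₂)
  have d2 : HasDerivAt F₂ (deriv F₂₁ l + deriv F₂₂ l) l := by
    rw [funext hdec₂]
    exact (d _ _ _ hF₂₁).add (d _ _ _ hF₂₂)
  have e1 : HasDerivAt S (deriv F₁₁ l * F₂ l + F₁₁ l * (deriv F₂₁ l + deriv F₂₂ l)
      - (deriv F₂₁ l * F₁ l + F₂₁ l * (deriv F₁₁ l + deriv F₁₂ l))) l := by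
    rw [funext (generatingFunction_eq hdec₁ hdec₂ hS)]
    exact ((d _ _ _ hF₁₁).mul d2).sub ((d _ _ _ hF₂₁).mul d1)
  have e2 : HasDerivAt (fun z => F₁₁ l * F₂ z - F₂₁ l * F₁ z)
      (F₁₁ l * (deriv F₂₁ l + deriv F₂₂ l) - F₂₁ l * (deriv F₁₁ l + deriv F₁₂ l)) l :=
    (d2.const_mul _).sub (d1.const_mul _)
  have e3 : HasDerivAt (fun z => (z - l) * v z) (1 * v l + (l - l) * deriv v l) l := ((hasDerivAt_id l).sub_const l).mul
    (differentiable_of_mem_paleyWiener isCompact_union_Icc hv l).hasDerivAt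
  rw [← funext h] at e3
  have e4 := e2.unique e3
  refine AnalyticAt.analyticOrderAt_eq_one_of_zero_deriv_ne_zero (hSd.analyticAt l)
    ((generatingFunction_eq_zero_iff hE hind hF₁₁ hF₂₁ hF₁₂ hF₂₂ hdec₁ hdec₂ h1 h2 hS l).2 hl) ?_
  rw [e1.deriv, h1 l hl, h2 l hl, mul_zero, mul_zero, zero_add, zero_add, e4]
  simpa using hv0

end GeneratingFunction

/-- The members of a biorthogonal system take the value `1` at their own point and vanish at the
others. -/
theorem biorthogonal_apply {E : Set ℝ} {Λ : Set ℂ} {f : ℂ → ℂ → ℂ} (hE : IsCompact E)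
    (hf : IsBiorthogonal E Λ f) {w v : ℂ} (hw : w ∈ Λ) (hv : v ∈ Λ) :
    f v w = if w = v then 1 else 0 := by
  have key := pwInner_pwKernel hE (hf.1 v hv) w
  split_ifs with h
  · subst h
    rw [hf.2.1 w hw] at key
    simpa using congrArg conj key.symm
  · rw [hf.2.2 w hw v hv h] at key
    simpa using key.symm

/-! ### Jensen's inequality. -/

open Metric Real in
/-- Jensen's inequality for finitely many zeros. -/
theorem sum_log_zeros_le {F : ℂ → ℂ} {c : ℂ} {ρ : ℝ} (hρ : 0 < ρ)
    (hF : AnalyticOnNhd ℂ F (closedBall c ρ)) (hc : F c ≠ 0) (s : Finset ℂ)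
    (hs : ∀ l ∈ s, l ∈ closedBall c ρ ∧ F l = 0) :
    ∑ l ∈ s, Real.log (ρ / ‖l - c‖) ≤ circleAverage (Real.log ‖F ·‖) c ρ - Real.log ‖F c‖ := by
  have hab : |ρ| = ρ := abs_of_pos hρ
  have hF' : AnalyticOnNhd ℂ F (closedBall c |ρ|) := by rwa [hab]
  rw [AnalyticOnNhd.circleAverage_log_norm hρ.ne' hF' hc, add_sub_cancel_right]
  set D := MeromorphicOn.divisor F (closedBall c |ρ|)
  have hfin := D.finiteSupport (isCompact_closedBall c |ρ|)
  have hDnn : ∀ u, 0 ≤ D u := fun u => MeromorphicOn.AnalyticOnNhd.divisor_nonneg hF' u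
  have hsub : (Function.support fun u => (D u : ℝ) * Real.log (ρ * ‖c - u‖⁻¹)) ⊆ hfin.toFinset := by
    intro u hu
    simp only [Function.mem_support] at hu
    simp only [Set.Finite.coe_toFinset, Function.mem_support]
    intro h
    simp [h] at hu
  have hlog : ∀ u ∈ closedBall c |ρ|, 0 ≤ Real.log (ρ * ‖c - u‖⁻¹) := by
    intro u hu
    rw [hab, mem_closedBall, dist_comm, dist_eq_norm] at hu
    -- At `u = c` the conventions `0⁻¹ = 0` and `log 0 = 0` make the term zero.
    rcases eq_or_lt_of_le (norm_nonneg (c - u)) with h | h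
    · simp [← h]
    · apply Real.log_nonneg
      rw [← div_eq_mul_inv, le_div_iff₀ h]
      linarith
  rw [finsum_eq_sum_of_support_subset _ hsub]
  -- `F c ≠ 0` excludes infinite order on the disc, so the divisor counts every zero at least once.
  have hD1 : ∀ l ∈ s, 1 ≤ D l := by
    intro l hl
    obtain ⟨hl1, hl2⟩ := hs l hl
    have hl1' : l ∈ closedBall c |ρ| := by rwa [hab]
    have hne : analyticOrderAt F l ≠ ⊤ :=
      hF'.analyticOrderAt_ne_top_of_isPreconnected (convex_closedBall c |ρ|).isPreconnected
        (x := c) (by simp) hl1' (by simp [(hF' c (by simp)).analyticOrderAt_eq_zero.2 hc])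
    have hne0 : analyticOrderAt F l ≠ 0 := by
      rw [ne_eq, (hF' l hl1').analyticOrderAt_eq_zero]
      simpa using hl2
    have : 0 ≠ D l := by
      rw [MeromorphicOn.AnalyticOnNhd.divisor_apply hF' hl1']
      intro h
      lift analyticOrderAt F l to ℕ using hne with n hn
      simp only [ENat.map_natCast, WithTop.untop₀_coe] at h
      exact hne0 (by exact_mod_cast h.symm)
    have := hDnn l
    omega
  have hss : s ⊆ hfin.toFinset := by
    intro l hl
    simp only [Set.Finite.mem_toFinset, Function.mem_support]
    have := hD1 l hl
    omega
  calc ∑ l ∈ s, Real.log (ρ / ‖l - c‖) ≤ ∑ l ∈ s, (D l : ℝ) * Real.log (ρ * ‖c - l‖⁻¹) := by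
        refine Finset.sum_le_sum fun l hl => ?_
        rw [norm_sub_rev l c, div_eq_mul_inv]
        have h1 : (1 : ℝ) ≤ D l := by exact_mod_cast hD1 l hl
        have := hlog l (by rw [hab]; exact (hs l hl).1)
        nlinarith
    _ ≤ _ := by
        refine Finset.sum_le_sum_of_subset_of_nonneg hss fun u hu _ => ?_
        refine mul_nonneg (by exact_mod_cast hDnn u) (hlog u ?_)
        exact D.supportWithinDomain ((Set.Finite.mem_toFinset hfin).1 hu)

/-! ### Bounded functions in the upper half-plane without exponential decay. -/

section UpperHalfPlane
variable {Q : ℂ → ℂ}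

/-- Inverse Blaschke factors tend to `1` at infinity, so they cost only a factor `1 + η` on the far
arc in the maximum principle. -/
theorem tendsto_conj_blaschke (w : ℂ) (m : ℕ) :
    Tendsto (fun z : ℂ => ‖((z - conj w) / (z - w)) ^ m‖) (Bornology.cobounded ℂ) (nhds 1) := by
  have h1 : Tendsto (fun z : ℂ => (z - w)⁻¹) (Bornology.cobounded ℂ) (nhds 0) :=
    tendsto_inv₀_cobounded.comp (tendsto_sub_const_cobounded w)
  have h2 : Tendsto (fun z : ℂ => ‖(1 + (w - conj w) * (z - w)⁻¹) ^ m‖) (Bornology.cobounded ℂ)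
      (nhds 1) := by
    have := (((h1.const_mul (w - conj w)).const_add 1).pow m).norm
    simpa using this
  refine h2.congr' ?_
  filter_upwards [Bornology.isBounded_def.1 (Bornology.isBounded_singleton (x := w))] with z hz
  have : z - w ≠ 0 := sub_ne_zero.2 hz
  congr 2
  field_simp
  ring

theorem norm_sub_conj_of_im_eq_zero {z : ℂ} (hz : z.im = 0) (w : ℂ) : ‖z - conj w‖ = ‖z - w‖ := by
  rw [← Complex.norm_conj (z - w), map_sub, Complex.conj_eq_iff_im.2 hz]

/-- A bounded function on the upper half-plane that is small on a disc is dominated outside of it by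
a power of a Blaschke factor. -/
theorem norm_le_blaschke_pow (hQ : DifferentiableOn ℂ Q {z | -1 < z.im})
    (hQ1 : ∀ z : ℂ, 0 ≤ z.im → ‖Q z‖ ≤ 1) {w : ℂ} {r : ℝ} (hr : 0 < r) {m : ℕ}
    (hs : ∀ z ∈ Metric.sphere w r, ‖Q z * ((z - conj w) / (z - w)) ^ m‖ ≤ 1) {z₀ : ℂ}
    (hz₀ : 0 < z₀.im) (hz₀w : z₀ ∉ Metric.closedBall w r) (hw : 0 < w.im) :
    ‖Q z₀‖ ≤ ‖(z₀ - w) / (z₀ - conj w)‖ ^ m := by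
  have key : ‖Q z₀ * ((z₀ - conj w) / (z₀ - w)) ^ m‖ ≤ 1 := by
    refine le_of_forall_pos_le_add fun η hη => ?_
    have h1 : ∀ᶠ z in Bornology.cobounded ℂ, ‖((z - conj w) / (z - w)) ^ m‖ < 1 + η :=
      (tendsto_conj_blaschke w m).eventually (gt_mem_nhds (by linarith))
    rw [Filter.HasBasis.eventually_iff (Metric.hasBasis_cobounded_compl_closedBall (0 : ℂ))] at h1
    obtain ⟨M, -, hM⟩ := h1
    -- The maximum principle is applied on a large half-disc with the small disc removed: `hs`
    -- controls the small circle, `|Q| ≤ 1` and unimodular factors the real axis, and the limit at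
    -- infinity the arc.
    set M' := max (M + 1) (‖z₀‖ + 1)
    set U : Set ℂ := ({z : ℂ | 0 < z.im} ∩ Metric.ball 0 M') ∩ (Metric.closedBall w r)ᶜ
    have hUo : IsOpen U := ((isOpen_lt continuous_const Complex.continuous_im).inter
      Metric.isOpen_ball).inter Metric.isClosed_closedBall.isOpen_compl
    have hUc : closure U ⊆ ({z : ℂ | 0 ≤ z.im} ∩ Metric.closedBall 0 M') ∩ (Metric.ball w r)ᶜ := by
      refine closure_minimal ?_ (((isClosed_le continuous_const Complex.continuous_im).inter
        Metric.isClosed_closedBall).inter Metric.isOpen_ball.isClosed_compl)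
      rintro z ⟨⟨h1, h2⟩, h3⟩
      exact ⟨⟨(show 0 < z.im from h1).le, Metric.ball_subset_closedBall h2⟩,
        fun h => h3 (Metric.ball_subset_closedBall h)⟩
    have hne : ∀ z ∈ closure U, z - w ≠ 0 := by
      intro z hz h0
      apply (hUc hz).2
      rw [sub_eq_zero.1 h0]
      exact Metric.mem_ball_self hr
    have hd : DiffContOnCl ℂ (fun z => Q z * ((z - conj w) / (z - w)) ^ m) U := by
      apply DifferentiableOn.diffContOnCl
      have hQc : DifferentiableOn ℂ Q (closure U) := hQ.mono fun z hz => by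
        have : 0 ≤ z.im := (hUc hz).1.1
        show -1 < z.im
        linarith
      refine hQc.mul (DifferentiableOn.pow (DifferentiableOn.div (by fun_prop) (by fun_prop) hne) m)
    have hfr : ∀ z ∈ frontier U, ‖Q z * ((z - conj w) / (z - w)) ^ m‖ ≤ 1 + η := by
      intro z hz
      rw [frontier, hUo.interior_eq] at hz
      obtain ⟨hzc, hzU⟩ := hz
      obtain ⟨⟨h1, h2⟩, h3⟩ := hUc hzc
      have h1' : 0 ≤ z.im := h1
      by_cases hb : z ∈ Metric.closedBall w r
      · have hsp : z ∈ Metric.sphere w r := le_antisymm hb (not_lt.1 h3)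
        exact (hs z hsp).trans (by linarith)
      · rcases eq_or_lt_of_le h1' with h0 | h0
        · rw [norm_mul, norm_pow, norm_div, norm_sub_conj_of_im_eq_zero h0.symm,
            div_self (norm_ne_zero_iff.2 (hne z hzc)), one_pow, mul_one]
          exact (hQ1 z h1').trans (by linarith)
        · have hzM : z ∉ Metric.ball 0 M' := fun h => hzU ⟨⟨h0, h⟩, hb⟩
          have hzM' : z ∈ (Metric.closedBall (0 : ℂ) M)ᶜ := by
            intro h
            apply hzM
            rw [mem_ball_zero_iff]
            rw [mem_closedBall_zero_iff] at h
            exact lt_of_le_of_lt h ((lt_add_one M).trans_le (le_max_left _ _))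
          rw [norm_mul]
          have := hQ1 z h1'
          have := (hM hzM').le
          nlinarith [norm_nonneg (Q z), norm_nonneg (((z - conj w) / (z - w)) ^ m)]
    have hbd : Bornology.IsBounded U :=
      Metric.isBounded_ball.subset (inter_subset_left.trans inter_subset_right)
    refine Complex.norm_le_of_forall_mem_frontier_norm_le hbd hd hfr (subset_closure ?_)
    refine ⟨⟨hz₀, ?_⟩, hz₀w⟩
    rw [mem_ball_zero_iff]
    exact (lt_add_one _).trans_le (le_max_right _ _)
  have hne : z₀ - w ≠ 0 := fun h => hz₀w (by
    rw [sub_eq_zero.1 h]; exact Metric.mem_closedBall_self hr.le)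
  have hne2 : z₀ - conj w ≠ 0 := fun h => by
    have := congrArg Complex.im h
    simp at this
    linarith
  rw [norm_mul, norm_pow, norm_div] at key
  rw [norm_div, div_pow, le_div_iff₀ (by positivity)]
  rwa [div_pow, ← mul_div_assoc, div_le_one (by positivity)] at key

/-- `|z - w|² = |z - w̄|² - 4 Im z Im w`, together with `1 - x ≤ e^{-x}`. -/
theorem norm_blaschke_le {z w : ℂ} (hz : 0 < z.im) (hw : 0 < w.im) :
    ‖(z - w) / (z - conj w)‖ ≤ Real.exp (-(2 * z.im * w.im / ‖z - conj w‖ ^ 2)) := by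
  have hne2 : z - conj w ≠ 0 := fun h => by
    have := congrArg Complex.im h
    simp at this
    linarith
  have hpos : 0 < ‖z - conj w‖ ^ 2 := by positivity
  have h1 : ‖z - w‖ ^ 2 = ‖z - conj w‖ ^ 2 - 4 * z.im * w.im := by
    rw [← Complex.normSq_eq_norm_sq, ← Complex.normSq_eq_norm_sq, Complex.normSq_apply,
      Complex.normSq_apply]
    simp
    ring
  have h2 : ‖(z - w) / (z - conj w)‖ ^ 2 ≤
      Real.exp (-(2 * z.im * w.im / ‖z - conj w‖ ^ 2)) ^ 2 := by
    rw [norm_div, div_pow, h1, ← Real.exp_nat_mul, sub_div, div_self hpos.ne']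
    have := Real.add_one_le_exp (((2 : ℕ) : ℝ) * -(2 * z.im * w.im / ‖z - conj w‖ ^ 2))
    refine le_trans (le_of_eq ?_) this
    push_cast
    ring
  exact le_of_sq_le_sq h2 (Real.exp_pos _).le

/-- If `Q` is bounded by `1` on the upper half-plane and has no exponential decay there, then at
every large scale there are points near any prescribed direction where `Q` is not small. -/
theorem eventually_exists_norm_gt (hQ : DifferentiableOn ℂ Q {z | -1 < z.im})
    (hQ1 : ∀ z : ℂ, 0 ≤ z.im → ‖Q z‖ ≤ 1)
    (hopt : ∀ ε : ℝ, 0 < ε → ∃ z : ℂ, 0 < z.im ∧ Real.exp (-(ε * z.im)) < ‖Q z‖)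
    {c : ℂ} {δ κ : ℝ} (hδ : 0 < δ) (hδc : δ < c.im) (hκ : 0 < κ) :
    ∀ᶠ R : ℝ in atTop, ∃ z : ℂ, ‖z - R * c‖ ≤ δ * R ∧ Real.exp (-(κ * R)) < ‖Q z‖ := by
  have hci : 0 < c.im := hδ.trans hδc
  have hcn : c.im ≤ ‖c‖ := (le_abs_self _).trans (Complex.abs_im_le_norm c)
  have hcp : 0 < ‖c‖ := hci.trans_le hcn
  -- `e^L` bounds the inverse Blaschke factor for `w = Rc` on the circle of radius `δR` about `w`.
  set L := Real.log ((2 * c.im + δ) / δ) with hLdef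
  have hL : 0 < L := Real.log_pos (by rw [lt_div_iff₀ hδ]; linarith)
  -- The rate is the one that `m ≈ κR/L` Blaschke factors would force at `z₀`; it does not depend on
  -- `R`.
  obtain ⟨z₀, hz₀, hz₀Q⟩ := hopt (κ * c.im / (4 * L * ‖c‖ ^ 2)) (by positivity)
  filter_upwards [eventually_gt_atTop 0, eventually_gt_atTop (‖z₀‖ / (‖c‖ - δ)),
    eventually_ge_atTop (2 * L / κ)] with R hR hR1 hR2
  by_contra! hcon
  have hcδ : 0 < ‖c‖ - δ := by linarith
  rw [div_lt_iff₀ hcδ] at hR1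
  rw [div_le_iff₀ hκ] at hR2
  set w : ℂ := R * c
  have hwi : w.im = R * c.im := by simp [w]
  have hwn : ‖w‖ = R * ‖c‖ := by simp [w, abs_of_pos hR]
  -- The largest power whose inverse Blaschke factors are compensated by `e^{-κR}`. Rounding loses
  -- at most half, since `R ≥ 2L/κ`.
  set m := ⌊κ * R / L⌋₊ with hm
  have hm1 : (m : ℝ) * L ≤ κ * R := by
    rw [← le_div_iff₀ hL]
    exact Nat.floor_le (by positivity)
  have hm2 : κ * R / (2 * L) ≤ m := by
    have h1 : κ * R / L < m + 1 := Nat.lt_floor_add_one _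
    have h2 : 1 ≤ κ * R / (2 * L) := by
      rw [le_div_iff₀ (by positivity)]
      linarith
    have h3 : κ * R / L = 2 * (κ * R / (2 * L)) := by field_simp
    linarith
  have hs : ∀ z ∈ Metric.sphere w (δ * R), ‖Q z * ((z - conj w) / (z - w)) ^ m‖ ≤ 1 := by
    intro z hz
    rw [mem_sphere_iff_norm] at hz
    have h1 : ‖z - conj w‖ ≤ δ * R + 2 * (R * c.im) := by
      have e : z - conj w = (z - w) + (w - conj w) := by ring
      rw [e]
      refine (norm_add_le _ _).trans ?_
      rw [hz, Complex.sub_conj, norm_mul]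
      simp only [Complex.norm_I, mul_one, Complex.norm_real, hwi, Real.norm_eq_abs]
      rw [abs_of_pos (by positivity)]
    have h2 : ‖(z - conj w) / (z - w)‖ ≤ Real.exp L := by
      rw [norm_div, hz, hLdef, Real.exp_log (by positivity), div_le_div_iff₀ (by positivity) hδ]
      nlinarith
    rw [norm_mul, norm_pow]
    calc ‖Q z‖ * ‖(z - conj w) / (z - w)‖ ^ m
        ≤ Real.exp (-(κ * R)) * Real.exp L ^ m := by
          gcongr
          exact hcon z hz.le
      _ = Real.exp (m * L - κ * R) := by
          rw [← Real.exp_nat_mul, ← Real.exp_add]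
          ring_nf
      _ ≤ 1 := Real.exp_le_one_iff.2 (by linarith)
  have hout : z₀ ∉ Metric.closedBall w (δ * R) := by
    rw [mem_closedBall_iff_norm', not_le]
    have := norm_sub_norm_le w z₀
    rw [hwn] at this
    nlinarith
  have key := norm_le_blaschke_pow hQ hQ1 (by positivity) hs hz₀ hout (by rw [hwi]; positivity)
  have hb := norm_blaschke_le hz₀ (w := w) (by rw [hwi]; positivity)
  have h1 : ‖z₀ - conj w‖ ≤ 2 * (R * ‖c‖) := by
    refine (norm_sub_le _ _).trans ?_
    rw [Complex.norm_conj, hwn]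
    nlinarith
  have hpos : 0 < ‖z₀ - conj w‖ := by
    refine norm_pos_iff.2 fun h => ?_
    have := congrArg Complex.im h
    simp [hwi] at this
    nlinarith
  have h2 : z₀.im * c.im / (2 * R * ‖c‖ ^ 2) ≤ 2 * z₀.im * w.im / ‖z₀ - conj w‖ ^ 2 := by
    have : ‖z₀ - conj w‖ ^ 2 ≤ (2 * (R * ‖c‖)) ^ 2 := by gcongr
    calc z₀.im * c.im / (2 * R * ‖c‖ ^ 2) = 2 * z₀.im * w.im / (2 * (R * ‖c‖)) ^ 2 := by
          rw [hwi]
          field_simp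
      _ ≤ _ := by
          rw [hwi]
          gcongr
  have h3 : ‖Q z₀‖ ≤ Real.exp (-(κ * c.im / (4 * L * ‖c‖ ^ 2) * z₀.im)) := by
    refine key.trans ((pow_le_pow_left₀ (norm_nonneg _) hb m).trans ?_)
    rw [← Real.exp_nat_mul]
    apply Real.exp_le_exp.2
    rw [mul_neg, neg_le_neg_iff]
    calc κ * c.im / (4 * L * ‖c‖ ^ 2) * z₀.im
        = κ * R / (2 * L) * (z₀.im * c.im / (2 * R * ‖c‖ ^ 2)) := by
          field_simp
          ring
      _ ≤ _ := by gcongr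
  linarith

end UpperHalfPlane

/-! ### Counting zeros at scale `R`; sparsity away from the real axis. -/

/-- The set `Z` has at most `d R` points in `R • A`, for all large `R`. -/
def ScaledCountLE (Z A : Set ℂ) (d : ℝ) : Prop :=
  ∀ᶠ R : ℝ in atTop, ∀ s : Finset ℂ, (∀ l ∈ s, l ∈ Z ∧ l / (R : ℂ) ∈ A) → (s.card : ℝ) ≤ d * R

section ScaledCount
variable {Z A B : Set ℂ} {d e : ℝ}

theorem ScaledCountLE.mono (h : ScaledCountLE Z A d) (hBA : B ⊆ A) : ScaledCountLE Z B d :=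
  Filter.Eventually.mono h fun _ hR s hs => hR s fun l hl => ⟨(hs l hl).1, hBA (hs l hl).2⟩

theorem ScaledCountLE.union (h : ScaledCountLE Z A d) (h' : ScaledCountLE Z B e) :
    ScaledCountLE Z (A ∪ B) (d + e) := by
  classical
  filter_upwards [h, h'] with R hR hR' s hs
  have h1 := hR (s.filter fun l => l / (R : ℂ) ∈ A) fun l hl =>
    ⟨(hs l (Finset.mem_filter.1 hl).1).1, (Finset.mem_filter.1 hl).2⟩
  have h2 := hR' (s.filter fun l => ¬ l / (R : ℂ) ∈ A) fun l hl =>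
    ⟨(hs l (Finset.mem_filter.1 hl).1).1,
      (hs l (Finset.mem_filter.1 hl).1).2.resolve_left (Finset.mem_filter.1 hl).2⟩
  have h3 : ((s.filter fun l => l / (R : ℂ) ∈ A).card : ℝ)
      + (s.filter fun l => ¬ l / (R : ℂ) ∈ A).card = s.card := by
    exact_mod_cast Finset.card_filter_add_card_filter_not _
  linarith

theorem ScaledCountLE.neg (h : ScaledCountLE Z A d) :
    ScaledCountLE {z | -z ∈ Z} {z | -z ∈ A} d := by
  classical
  filter_upwards [h] with R hR s hs
  have := hR (s.image fun z => -z) fun l hl => by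
    obtain ⟨z, hz, rfl⟩ := Finset.mem_image.1 hl
    refine ⟨(hs z hz).1, ?_⟩
    rw [neg_div]
    exact (hs z hz).2
  rwa [Finset.card_image_of_injective _ neg_injective] at this

theorem scaledCountLE_empty (hd : 0 ≤ d) : ScaledCountLE Z ∅ d := by
  filter_upwards [eventually_ge_atTop 0] with R hR s hs
  have : s = ∅ := Finset.eq_empty_of_forall_notMem fun l hl => (hs l hl).2
  subst this
  simpa using mul_nonneg hd hR

/-- Off the real axis the zeros of a bounded function without exponential decay are sparse. -/
theorem exists_ball_scaledCountLE {Q : ℂ → ℂ} (hQ : DifferentiableOn ℂ Q {z | -1 < z.im})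
    (hQ1 : ∀ z : ℂ, 0 ≤ z.im → ‖Q z‖ ≤ 1)
    (hopt : ∀ ε : ℝ, 0 < ε → ∃ z : ℂ, 0 < z.im ∧ Real.exp (-(ε * z.im)) < ‖Q z‖)
    {c : ℂ} (hc : 0 < c.im) :
    ∃ r : ℝ, 0 < r ∧ ∀ κ : ℝ, 0 < κ → ScaledCountLE {z | Q z = 0} (Metric.ball c r) κ := by
  -- A centre `z` within `R Im c / 8` of `Rc` is within `R Im c / 4` of every zero counted. Jensen's
  -- inequality on the disc of radius `R Im c / 2` then charges each zero at least `log 2`.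
  refine ⟨c.im / 8, by positivity, fun κ hκ => ?_⟩
  have hl2 : 0 < Real.log 2 := Real.log_pos one_lt_two
  filter_upwards [eventually_exists_norm_gt hQ hQ1 hopt (c := c) (δ := c.im / 8)
    (κ := κ * Real.log 2) (by positivity) (by linarith) (by positivity),
    eventually_gt_atTop 0] with R hR hR0 s hs
  obtain ⟨z, hz1, hz2⟩ := hR
  have hRc : 0 < R * c.im := by positivity
  have hzim : R * c.im * (7 / 8) ≤ z.im := by
    have := (Complex.abs_im_le_norm (z - R * c)).trans hz1
    rw [abs_le] at this
    simp at this
    linarith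
  have hball : ∀ w ∈ Metric.closedBall z (R * c.im / 2), 0 < w.im := by
    intro w hw
    rw [mem_closedBall_iff_norm] at hw
    have := (Complex.abs_im_le_norm (w - z)).trans hw
    rw [abs_le] at this
    simp at this
    linarith
  have hopen : IsOpen {z : ℂ | -1 < z.im} := isOpen_lt continuous_const Complex.continuous_im
  have han : AnalyticOnNhd ℂ Q (Metric.closedBall z (R * c.im / 2)) :=
    (hQ.analyticOnNhd hopen).mono fun w hw => by
      have := hball w hw
      show -1 < w.im
      linarith
  have hQz : Q z ≠ 0 := by
    intro h
    rw [h, norm_zero] at hz2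
    exact absurd hz2 (Real.exp_pos _).not_gt
  have hclose : ∀ l ∈ s, ‖l - z‖ ≤ R * c.im / 4 := by
    intro l hl
    have h1 := (hs l hl).2
    rw [mem_ball_iff_norm] at h1
    have h2 : ‖l - R * c‖ ≤ R * (c.im / 8) := by
      have : l - R * c = R * (l / R - c) := by
        have : (R : ℂ) ≠ 0 := by exact_mod_cast hR0.ne'
        field_simp
      rw [this, norm_mul, Complex.norm_real, Real.norm_of_nonneg hR0.le]
      gcongr
    have h3 : l - z = (l - R * c) - (z - R * c) := by ring
    rw [h3]
    refine (norm_sub_le _ _).trans ?_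
    linarith
  have hJ := sum_log_zeros_le (F := Q) (c := z) (ρ := R * c.im / 2) (by positivity) han hQz s
    fun l hl => ⟨by rw [mem_closedBall_iff_norm]; linarith [hclose l hl], (hs l hl).1⟩
  have hlow : (s.card : ℝ) * Real.log 2 ≤ ∑ l ∈ s, Real.log (R * c.im / 2 / ‖l - z‖) := by
    rw [← nsmul_eq_mul]
    refine Finset.card_nsmul_le_sum _ _ _ fun l hl => ?_
    have hlz : 0 < ‖l - z‖ := norm_pos_iff.2 (sub_ne_zero.2 fun h => hQz (h ▸ (hs l hl).1))
    apply Real.log_le_log two_pos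
    rw [le_div_iff₀ hlz]
    linarith [hclose l hl]
  have havg : Real.circleAverage (Real.log ‖Q ·‖) z (R * c.im / 2) ≤ 0 := by
    apply Real.circleAverage_mono_on_of_le_circle
    · apply MeromorphicOn.circleIntegrable_log_norm
      rw [abs_of_pos (by positivity)]
      exact (han.mono Metric.sphere_subset_closedBall).meromorphicOn
    · intro w hw
      rw [abs_of_pos (by positivity)] at hw
      exact Real.log_nonpos (norm_nonneg _)
        (hQ1 w (hball w (Metric.sphere_subset_closedBall hw)).le)
  have hlog : -(κ * Real.log 2 * R) ≤ Real.log ‖Q z‖ := by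
    rw [← Real.log_exp (-(κ * Real.log 2 * R))]
    exact Real.log_le_log (Real.exp_pos _) hz2.le
  have : (s.card : ℝ) * Real.log 2 ≤ κ * R * Real.log 2 := by linarith
  exact le_of_mul_le_mul_right this hl2

/-- Compactness reduces this to small balls. The quantifier over `κ` is part of the induction
predicate so that a union can split `κ` in halves. -/
theorem scaledCountLE_of_isCompact {Q : ℂ → ℂ} (hQ : DifferentiableOn ℂ Q {z | -1 < z.im})
    (hQ1 : ∀ z : ℂ, 0 ≤ z.im → ‖Q z‖ ≤ 1)
    (hopt : ∀ ε : ℝ, 0 < ε → ∃ z : ℂ, 0 < z.im ∧ Real.exp (-(ε * z.im)) < ‖Q z‖)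
    {K : Set ℂ} (hK : IsCompact K) (hKpos : ∀ z ∈ K, 0 < z.im) :
    ∀ κ : ℝ, 0 < κ → ScaledCountLE {z | Q z = 0} K κ := by
  refine hK.induction_on (p := fun A => ∀ κ : ℝ, 0 < κ → ScaledCountLE {z | Q z = 0} A κ)
    (fun κ hκ => scaledCountLE_empty hκ.le) (fun A B hAB h κ hκ => (h κ hκ).mono hAB)
    (fun A B hA hB κ hκ => ?_) (fun c hc => ?_)
  · have := (hA (κ / 2) (by positivity)).union (hB (κ / 2) (by positivity))
    rwa [add_halves] at this
  · obtain ⟨r, hr, h⟩ := exists_ball_scaledCountLE hQ hQ1 hopt (hKpos c hc)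
    exact ⟨_, mem_nhdsWithin_of_mem_nhds (Metric.ball_mem_nhds c hr), h⟩

end ScaledCount

/-! ### Circle averages and the logarithmic kernel. -/

theorem integral_abs_sin_two_pi : ∫ θ in (0 : ℝ)..2 * Real.pi, |Real.sin θ| = 4 := by
  have hc : Continuous fun θ : ℝ => |Real.sin θ| := Real.continuous_sin.abs
  rw [← intervalIntegral.integral_add_adjacent_intervals (b := Real.pi)
    (hc.intervalIntegrable _ _) (hc.intervalIntegrable _ _)]
  have h1 : ∫ θ in (0 : ℝ)..Real.pi, |Real.sin θ| = ∫ θ in (0 : ℝ)..Real.pi, Real.sin θ := by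
    apply intervalIntegral.integral_congr
    intro θ hθ
    rw [uIcc_of_le Real.pi_pos.le] at hθ
    exact abs_of_nonneg (Real.sin_nonneg_of_mem_Icc hθ)
  have h2 : ∫ θ in Real.pi..2 * Real.pi, |Real.sin θ|
      = ∫ θ in Real.pi..2 * Real.pi, -Real.sin θ := by
    apply intervalIntegral.integral_congr
    intro θ hθ
    rw [uIcc_of_le (by linarith [Real.pi_pos])] at hθ
    refine abs_of_nonpos ?_
    have := Real.sin_nonneg_of_mem_Icc (x := θ - Real.pi) ⟨by linarith [hθ.1], by linarith [hθ.2]⟩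
    rw [Real.sin_sub_pi] at this
    linarith
  rw [h1, h2, integral_sin, intervalIntegral.integral_neg, integral_sin]
  simp
  norm_num

/-- The mean of `|sin|` is `2/π`; this is where the `π` of the density bound comes from. -/
theorem circleAverage_abs_im_le (c : ℂ) {ρ : ℝ} (hρ : 0 ≤ ρ) :
    Real.circleAverage (fun z => |z.im|) c ρ ≤ |c.im| + 2 * ρ / Real.pi := by
  have hpi := Real.pi_pos
  have hc1 : Continuous fun θ : ℝ => |(circleMap c ρ θ).im| :=
    (Complex.continuous_im.comp (continuous_circleMap c ρ)).abs
  have hc2 : Continuous fun θ : ℝ => |c.im| + ρ * |Real.sin θ| := by fun_prop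
  have h1 : ∫ θ in (0 : ℝ)..2 * Real.pi, |(circleMap c ρ θ).im|
      ≤ ∫ θ in (0 : ℝ)..2 * Real.pi, (|c.im| + ρ * |Real.sin θ|) := by
    apply intervalIntegral.integral_mono_on (by positivity) (hc1.intervalIntegrable _ _)
      (hc2.intervalIntegrable _ _)
    intro θ _
    have : (circleMap c ρ θ).im = c.im + ρ * Real.sin θ := by
      simp [circleMap, Complex.exp_im]
    rw [this]
    refine (abs_add_le _ _).trans ?_
    rw [abs_mul, abs_of_nonneg hρ]
  have h2 : ∫ θ in (0 : ℝ)..2 * Real.pi, (|c.im| + ρ * |Real.sin θ|)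
      = 2 * Real.pi * |c.im| + ρ * 4 := by
    rw [intervalIntegral.integral_add (continuous_const.intervalIntegrable _ _)
      ((by fun_prop : Continuous fun θ : ℝ => ρ * |Real.sin θ|).intervalIntegrable _ _),
      intervalIntegral.integral_const, intervalIntegral.integral_const_mul, integral_abs_sin_two_pi]
    simp
  rw [h2] at h1
  rw [Real.circleAverage_def, smul_eq_mul, inv_mul_le_iff₀ (by positivity)]
  refine h1.trans (le_of_eq ?_)
  field_simp
  ring

theorem circleAverage_log_norm_le {F : ℂ → ℂ} (hF : Differentiable ℂ F) {C H : ℝ} (hC : 1 ≤ C)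
    (hH : 0 ≤ H) (hFb : ∀ z, ‖F z‖ ≤ C * (1 + ‖z‖) ^ 2 * Real.exp (H * |z.im|)) (c : ℂ) {ρ : ℝ}
    (hρ : 0 ≤ ρ) : Real.circleAverage (Real.log ‖F ·‖) c ρ
      ≤ Real.log (C * (1 + ‖c‖ + ρ) ^ 2) + H * (|c.im| + 2 * ρ / Real.pi) := by
  have hcn := norm_nonneg c
  have hci : CircleIntegrable (fun z : ℂ => |z.im|) c ρ :=
    (Complex.continuous_im.abs.comp (continuous_circleMap c ρ)).intervalIntegrable _ _
  have hpos : ∀ x : ℝ, 0 ≤ x → 1 ≤ C * (1 + x) ^ 2 := fun x hx =>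
    one_le_mul_of_one_le_of_one_le hC (one_le_pow₀ (by linarith))
  have h1 : Real.circleAverage (Real.log ‖F ·‖) c ρ ≤ Real.circleAverage
      (fun z => Real.log (C * (1 + ‖c‖ + ρ) ^ 2) + H * |z.im|) c ρ := by
    apply Real.circleAverage_mono
    · apply MeromorphicOn.circleIntegrable_log_norm
      exact fun z _ => (hF.analyticAt z).meromorphicAt
    · exact (continuous_const.add (continuous_const.mul
        (Complex.continuous_im.abs.comp (continuous_circleMap c ρ)))).intervalIntegrable _ _
    · intro z hz
      rw [abs_of_nonneg hρ, mem_sphere_iff_norm] at hz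
      have hzn : ‖z‖ ≤ ‖c‖ + ρ := by
        have := norm_sub_norm_le z c
        linarith
      have hX : 1 ≤ C * (1 + ‖c‖ + ρ) ^ 2 := by
        rw [add_assoc]
        exact hpos _ (by positivity)
      -- At zeros of `F` the convention `log 0 = 0` requires a nonnegative majorant, which `1 ≤ C`
      -- provides.
      rcases eq_or_ne (F z) 0 with h0 | h0
      · simp only [h0, norm_zero, Real.log_zero]
        exact add_nonneg (Real.log_nonneg hX) (by positivity)
      · rw [← Real.log_exp (H * |z.im|), ← Real.log_mul (by positivity) (Real.exp_pos _).ne']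
        apply Real.log_le_log (norm_pos_iff.2 h0)
        refine (hFb z).trans ?_
        rw [add_assoc]
        gcongr
  refine h1.trans ?_
  have hci' : CircleIntegrable (fun z : ℂ => H * |z.im|) c ρ := hci.const_mul H
  rw [Real.circleAverage_fun_add (circleIntegrable_const _ _ _) hci',
    Real.circleAverage_const]
  have : Real.circleAverage (fun z : ℂ => H * |z.im|) c ρ
      = H * Real.circleAverage (fun z : ℂ => |z.im|) c ρ := by
    simpa using Real.circleAverage_fun_smul (a := H) (f := fun z : ℂ => |z.im|) (c := c) (R := ρ)
  rw [this]
  gcongr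
  exact circleAverage_abs_im_le c hρ

/-- A discrete form of `∫₀¹ log(1/x) dx = 1`: the sum equals `n log(n+1) - log (n+1)!`. The
induction step rests on `(n+2) log((n+2)/(n+1)) ≥ 1`. -/
theorem sum_log_div_ge (n : ℕ) :
    (n : ℝ) - 2 * Real.log (n + 1) ≤ ∑ k ∈ Finset.range n, Real.log ((n + 1) / (k + 2)) := by
  induction n with
  | zero => simp
  | succ n ih =>
    have hn : (0 : ℝ) < n + 1 := by positivity
    have hn2 : (0 : ℝ) < n + 2 := by positivity
    have e : ∀ k : ℕ, Real.log (((n : ℝ) + 1 + 1) / (k + 2))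
        = Real.log ((n + 1) / (k + 2)) + (Real.log (n + 2) - Real.log (n + 1)) := by
      intro k
      have hk : (0 : ℝ) < k + 2 := by positivity
      rw [Real.log_div (by positivity) hk.ne', Real.log_div hn.ne' hk.ne',
        show (n : ℝ) + 1 + 1 = n + 2 by ring]
      ring
    have h1 : 1 ≤ (n + 2) * (Real.log (n + 2) - Real.log (n + 1)) := by
      have := Real.one_sub_inv_le_log_of_pos (div_pos hn2 hn)
      rw [Real.log_div hn2.ne' hn.ne', inv_div] at this
      have h2 : 1 - ((n : ℝ) + 1) / (n + 2) = 1 / (n + 2) := by field_simp; ring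
      rw [h2, div_le_iff₀ hn2] at this
      linarith
    push_cast
    rw [Finset.sum_range_succ]
    simp only [e, Finset.sum_add_distrib, Finset.sum_const, Finset.card_range, nsmul_eq_mul]
    have h3 : Real.log (((n : ℝ) + 1) / (n + 2)) = Real.log (n + 1) - Real.log (n + 2) :=
      Real.log_div hn.ne' hn2.ne'
    rw [h3, show (n : ℝ) + 1 + 1 = n + 2 by ring]
    linarith

/-- A number `n` for which the discretised logarithmic kernel has almost full mass. -/
theorem exists_nat_kernel_mass (a b ε : ℝ) (hε : 0 < ε) :
    ∃ n : ℕ, 0 < (n : ℝ) - 2 * Real.log (n + 1) ∧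
      a * (n + 1) + b < (a + ε) * (n - 2 * Real.log (n + 1)) := by
  -- Since `log(n+1) = o(n)`, the two sides grow like `an` and `(a + ε)n`.
  have h1 : Tendsto (fun n : ℕ => Real.log ((n : ℝ) + 1) / n) atTop (nhds 0) := by
    have h2 : Tendsto (fun x : ℝ => Real.log x / x) atTop (nhds 0) :=
      Real.isLittleO_log_id_atTop.tendsto_div_nhds_zero
    have h3 : Tendsto (fun n : ℕ => (n : ℝ) + 1) atTop atTop :=
      tendsto_atTop_add_const_right _ _ tendsto_natCast_atTop_atTop
    have h4 := (h2.comp h3).mul (tendsto_one_div_atTop_nhds_zero_nat.const_add (1 : ℝ))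
    rw [zero_mul] at h4
    refine h4.congr' ?_
    filter_upwards [eventually_gt_atTop 0] with n hn
    have : (0 : ℝ) < n := by exact_mod_cast hn
    simp only [Function.comp]
    field_simp
  have h5 : Tendsto (fun n : ℕ => (a + ε) * (1 - 2 * (Real.log ((n : ℝ) + 1) / n)) - a
      - (a + b) * (1 / (n : ℝ))) atTop (nhds ((a + ε) * (1 - 2 * 0) - a - (a + b) * 0)) :=
    (((h1.const_mul 2).const_sub 1).const_mul _ |>.sub_const a).sub
      (tendsto_one_div_atTop_nhds_zero_nat.const_mul _)
  have h6 : Tendsto (fun n : ℕ => 1 - 2 * (Real.log ((n : ℝ) + 1) / n)) atTop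
      (nhds (1 - 2 * 0)) := (h1.const_mul 2).const_sub 1
  have h7 := h5.eventually (lt_mem_nhds (a := 0) (by linarith))
  have h8 := h6.eventually (lt_mem_nhds (a := 0) (by norm_num))
  obtain ⟨n, hn7, hn8, hn⟩ := (h7.and (h8.and (eventually_gt_atTop 0))).exists
  have hn0 : (0 : ℝ) < n := by exact_mod_cast hn
  refine ⟨n, ?_, ?_⟩
  · have := mul_pos hn8 hn0
    field_simp at this
    linarith
  · have := mul_pos hn7 hn0
    field_simp at this
    linarith

/-- Polynomial factors are negligible at the exponential scale. -/
theorem eventually_log_poly_le (C A s : ℝ) (hC : 1 ≤ C) (hA : 0 ≤ A) (hs : 0 < s) :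
    ∀ᶠ R : ℝ in atTop, Real.log (C * (1 + A * R) ^ 2) ≤ s * R := by
  have h1 : Tendsto (fun R : ℝ => Real.exp (s * R) / R ^ 2) atTop atTop := by
    have h2 : Tendsto (fun R : ℝ => s * R) atTop atTop := tendsto_id.const_mul_atTop hs
    have h3 := (Real.tendsto_exp_div_pow_atTop 2).comp h2
    have h4 := h3.const_mul_atTop (r := s ^ 2) (by positivity)
    refine h4.congr' ?_
    filter_upwards [eventually_gt_atTop 0] with R hR
    simp only [Function.comp]
    field_simp
  filter_upwards [h1.eventually_ge_atTop (C * (1 + A) ^ 2), eventually_ge_atTop 1] with R hR hR1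
  have hR0 : 0 < R := by linarith
  rw [le_div_iff₀ (by positivity)] at hR
  rw [Real.log_le_iff_le_exp (by positivity)]
  refine le_trans ?_ hR
  rw [mul_assoc, ← mul_pow]
  gcongr
  nlinarith

/-! ### Sharp count of the zeros near the real axis. -/

section Strip
open Real (posLog)

/-- The logarithmic kernels at the points of a lattice add up to at least the mass computed by
`sum_log_div_ge`. -/
theorem le_sum_posLog {n K : ℕ} (hK : 0 < K) {R : ℝ} (hR : 0 < R) (c : ℤ → ℂ)
    (hc : ∀ j ∈ Finset.Icc (-((K : ℤ) + n)) (K + n),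
      ‖c j - ((R * j / K : ℝ) : ℂ)‖ ≤ R / (2 * K))
    {l : ℂ} (hl : |l.re| ≤ R) (hli : |l.im| ≤ R / (2 * K))
    (hlc : ∀ j ∈ Finset.Icc (-((K : ℤ) + n)) (K + n), l ≠ c j) :
    2 * ((n : ℝ) - 2 * Real.log (n + 1)) ≤ ∑ j ∈ Finset.Icc (-((K : ℤ) + n)) (K + n),
      posLog ((n + 1) * R / K / ‖l - c j‖) := by
  classical
  have hK0 : (0 : ℝ) < K := by exact_mod_cast hK
  -- The cell containing `Re l`; the `n` lattice points on each side of it carry the mass.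
  set i : ℤ := ⌊l.re * K / R⌋
  have hi1 : (i : ℝ) ≤ l.re * K / R := Int.floor_le _
  have hi2 : l.re * K / R < i + 1 := Int.lt_floor_add_one _
  rw [abs_le] at hl
  have hiK1 : -(K : ℤ) ≤ i := by
    apply Int.le_floor.2
    rw [le_div_iff₀ hR]
    push_cast
    nlinarith
  have hiK2 : i ≤ K := by
    have : (i : ℝ) ≤ K := hi1.trans (by rw [div_le_iff₀ hR]; nlinarith)
    exact_mod_cast this
  rw [le_div_iff₀ hR] at hi1
  rw [div_lt_iff₀ hR] at hi2
  -- The `k`-th point on either side is at horizontal distance at most `(k+1)R/K`. The height of `l`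
  -- and the displacement of `c j` add `R/(2K)` each, so the distance is at most `(k+2)R/K`.
  have hterm : ∀ (k : ℕ) (j : ℤ), j ∈ Finset.Icc (-((K : ℤ) + n)) (K + n) → k < n →
      |l.re - R * j / K| ≤ (k + 1) * (R / K) →
      Real.log ((n + 1) / (k + 2)) ≤ posLog ((n + 1) * R / K / ‖l - c j‖) := by
    intro k j hj hk habs
    have hpos : 0 < ‖l - c j‖ := norm_pos_iff.2 (sub_ne_zero.2 (hlc j hj))
    have h1 : ‖l - c j‖ ≤ (k + 2) * (R / K) := by
      have e : l - c j = (l - ((R * j / K : ℝ) : ℂ)) - (c j - ((R * j / K : ℝ) : ℂ)) := by ring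
      have h2 : ‖l - ((R * j / K : ℝ) : ℂ)‖ ≤ (k + 1) * (R / K) + R / (2 * K) := by
        refine (Complex.norm_le_abs_re_add_abs_im _).trans ?_
        rw [Complex.sub_re, Complex.sub_im, Complex.ofReal_re, Complex.ofReal_im, sub_zero]
        exact add_le_add habs hli
      have h3 : R / (2 * K) + R / (2 * K) = R / K := by field_simp; norm_num
      rw [e]
      refine (norm_sub_le _ _).trans ?_
      have := hc j hj
      linarith
    have hle : ((n : ℝ) + 1) / (k + 2) ≤ (n + 1) * R / K / ‖l - c j‖ := by
      rw [div_le_div_iff₀ (by positivity) hpos]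
      calc ((n : ℝ) + 1) * ‖l - c j‖ ≤ (n + 1) * ((k + 2) * (R / K)) := by gcongr
        _ = _ := by ring
    exact (Real.log_le_log (by positivity) hle).trans (le_max_right _ _)
  set A₁ := (Finset.range n).image fun k : ℕ => i - (k : ℤ)
  set A₂ := (Finset.range n).image fun k : ℕ => i + 1 + (k : ℤ)
  have hA : A₁ ∪ A₂ ⊆ Finset.Icc (-((K : ℤ) + n)) (K + n) := by
    intro j hj
    simp only [A₁, A₂, Finset.mem_union, Finset.mem_image, Finset.mem_range] at hj
    rw [Finset.mem_Icc]
    rcases hj with ⟨k, hk, rfl⟩ | ⟨k, hk, rfl⟩ <;> constructor <;> omega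
  have hdisj : Disjoint A₁ A₂ := by
    rw [Finset.disjoint_left]
    intro j h1 h2
    simp only [A₁, A₂, Finset.mem_image, Finset.mem_range] at h1 h2
    obtain ⟨k, hk, rfl⟩ := h1
    obtain ⟨k', hk', h⟩ := h2
    omega
  refine le_trans ?_ (Finset.sum_le_sum_of_subset_of_nonneg hA fun _ _ _ => le_max_left _ _)
  rw [Finset.sum_union hdisj, Finset.sum_image (fun _ _ _ _ h => by simpa using h),
    Finset.sum_image (fun _ _ _ _ h => by simpa using h), two_mul]
  refine add_le_add ?_ ?_
  · refine (sum_log_div_ge n).trans (Finset.sum_le_sum fun k hk => ?_)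
    refine hterm k _ (hA ?_) (Finset.mem_range.1 hk) ?_
    · exact Finset.mem_union_left _ (Finset.mem_image_of_mem _ hk)
    · push_cast
      have e : l.re - R * (i - k) / K = (l.re * K - i * R + k * R) / K := by field_simp; ring
      have e2 : ((k : ℝ) + 1) * (R / K) = (k + 1) * R / K := by ring
      rw [e, e2, abs_div, abs_of_pos hK0]
      gcongr
      have : 0 ≤ (k : ℝ) * R := by positivity
      rw [abs_of_nonneg (by linarith)]
      linarith
  · refine (sum_log_div_ge n).trans (Finset.sum_le_sum fun k hk => ?_)
    refine hterm k _ (hA ?_) (Finset.mem_range.1 hk) ?_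
    · exact Finset.mem_union_right _ (Finset.mem_image_of_mem _ hk)
    · push_cast
      have e : l.re - R * (i + 1 + k) / K = -((i + 1) * R - l.re * K + k * R) / K := by
        field_simp; ring
      have e2 : ((k : ℝ) + 1) * (R / K) = (k + 1) * R / K := by ring
      rw [e, e2, abs_div, abs_of_pos hK0, abs_neg]
      gcongr
      have : 0 ≤ (k : ℝ) * R := by positivity
      rw [abs_of_nonneg (by linarith)]
      linarith

/-- Sharp upper bound for the number of zeros close to the real axis. -/
theorem exists_strip_scaledCountLE {F : ℂ → ℂ} (hF : Differentiable ℂ F) {C H : ℝ} (hC : 1 ≤ C)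
    (hH : 0 ≤ H) (hFb : ∀ z, ‖F z‖ ≤ C * (1 + ‖z‖) ^ 2 * Real.exp (H * |z.im|))
    (hgood : ∀ x δ κ : ℝ, 0 < δ → 0 < κ → ∀ᶠ R : ℝ in atTop,
      ∃ z : ℂ, ‖z - ((R * x : ℝ) : ℂ)‖ ≤ δ * R ∧ F z ≠ 0 ∧ -(κ * R) ≤ Real.log ‖F z‖)
    {ε : ℝ} (hε : 0 < ε) :
    ∃ τ : ℝ, 0 < τ ∧ ScaledCountLE {z | F z = 0} {z | |z.re| ≤ 1 ∧ |z.im| ≤ τ}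
      (2 * H / Real.pi + ε) := by
  -- In units of `R/K`, Jensen's inequality at one centre, with radius `(n+1)R/K`, costs at most
  -- `A`. In the constant `H + 2`, `H` pays for the height of the centre, and `2` for the polynomial
  -- factor and for the lower bound of `log ‖F‖` at the centre.
  obtain ⟨n, hD, hn⟩ := exists_nat_kernel_mass (2 * H / Real.pi) (H + 2) (ε / 2) (by positivity)
  set D : ℝ := (n : ℝ) - 2 * Real.log (n + 1)
  set A : ℝ := 2 * H / Real.pi * (n + 1) + (H + 2)
  have hA0 : 0 ≤ A := by positivity
  -- `K` is so large that the `2n + 1` centres in excess of `2K` cost only `ε/2` in the final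
  -- density.
  obtain ⟨K, hK, hK0⟩ : ∃ K : ℕ, (2 * n + 1) * A ≤ K * (ε * D) ∧ 0 < K := by
    obtain ⟨K, hK⟩ := exists_nat_ge ((2 * n + 1) * A / (ε * D))
    refine ⟨K + 1, ?_, Nat.succ_pos _⟩
    rw [div_le_iff₀ (by positivity)] at hK
    push_cast
    nlinarith [mul_pos hε hD]
  have hKr : (0 : ℝ) < K := by exact_mod_cast hK0
  refine ⟨1 / (2 * K), by positivity, ?_⟩
  -- `F` may vanish or be tiny at a lattice point, so each centre is moved slightly to a point where
  -- `F` is not small.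
  have hall : ∀ᶠ R : ℝ in atTop, ∀ j ∈ Finset.Icc (-((K : ℤ) + n)) (K + n), ∃ z : ℂ,
      ‖z - ((R * (j / K) : ℝ) : ℂ)‖ ≤ 1 / (2 * K) * R ∧ F z ≠ 0 ∧
        -(1 / K * R) ≤ Real.log ‖F z‖ := by
    rw [Filter.eventually_all_finset]
    intro j _
    exact hgood _ _ _ (by positivity) (by positivity)
  set B : ℝ := (K + n) / K + 1 / (2 * K) + (n + 1) / K
  filter_upwards [hall, eventually_gt_atTop 0, eventually_log_poly_le C B (1 / K) hC (by positivity)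
    (by positivity)] with R hR hR0 hpoly s hs
  choose! c hc1 hc2 hc3 using hR
  set ρ : ℝ := (n + 1) * R / K
  have hρ : 0 < ρ := by positivity
  have hc : ∀ j ∈ Finset.Icc (-((K : ℤ) + n)) (K + n),
      ‖c j - ((R * j / K : ℝ) : ℂ)‖ ≤ R / (2 * K) := by
    intro j hj
    have := hc1 j hj
    rw [← mul_div_assoc] at this
    refine this.trans (le_of_eq ?_)
    ring
  have hcenter : ∀ j ∈ Finset.Icc (-((K : ℤ) + n)) (K + n),
      ∑ l ∈ s, posLog (ρ / ‖l - c j‖) ≤ R / K * A := by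
    intro j hj
    have hcim : |(c j).im| ≤ R / K := by
      have := (Complex.abs_im_le_norm _).trans (hc j hj)
      rw [Complex.sub_im, Complex.ofReal_im, sub_zero] at this
      refine this.trans ?_
      gcongr
      linarith
    have hcn : ‖c j‖ + ρ ≤ B * R := by
      have h1 : ‖c j‖ ≤ R * (K + n) / K + R / (2 * K) := by
        have e : c j = ((R * j / K : ℝ) : ℂ) + (c j - ((R * j / K : ℝ) : ℂ)) := by ring
        rw [e]
        refine (norm_add_le _ _).trans (add_le_add ?_ (hc j hj))
        rw [Complex.norm_real, Real.norm_eq_abs, abs_div, abs_mul, abs_of_pos hR0, abs_of_pos hKr]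
        gcongr
        rw [Finset.mem_Icc] at hj
        rw [abs_le]
        constructor
        · exact_mod_cast hj.1
        · exact_mod_cast hj.2
      have h2 : B * R = R * (K + n) / K + R / (2 * K) + ρ := by simp only [B, ρ]; ring
      linarith
    have havg := circleAverage_log_norm_le hF hC hH hFb (c j) hρ.le
    have hlog : Real.log (C * (1 + ‖c j‖ + ρ) ^ 2) ≤ 1 / K * R := by
      refine le_trans (Real.log_le_log (by positivity) ?_) hpoly
      rw [add_assoc]
      gcongr
    set s' := s.filter fun l => ‖l - c j‖ ≤ ρ
    have hJ := sum_log_zeros_le (F := F) (c := c j) hρ (fun z _ => hF.analyticAt z) (hc2 j hj) s'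
      fun l hl => ⟨by rw [mem_closedBall_iff_norm]; exact (Finset.mem_filter.1 hl).2,
        (hs l (Finset.mem_filter.1 hl).1).1⟩
    have hsum : ∑ l ∈ s, posLog (ρ / ‖l - c j‖) = ∑ l ∈ s', Real.log (ρ / ‖l - c j‖) := by
      rw [Finset.sum_filter]
      refine Finset.sum_congr rfl fun l hl => ?_
      have hpos : 0 < ‖l - c j‖ := norm_pos_iff.2 (sub_ne_zero.2 fun h => hc2 j hj
        (h ▸ (hs l hl).1))
      split_ifs with h
      · rw [Real.posLog_eq_log]
        rw [abs_of_pos (by positivity), le_div_iff₀ hpos]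
        linarith
      · rw [Real.posLog_eq_zero_iff, abs_of_pos (by positivity), div_le_one hpos]
        linarith
    rw [hsum]
    have h3 := hc3 j hj
    have h4 : H * (|(c j).im| + 2 * ρ / Real.pi) ≤ H * (R / K + 2 * ρ / Real.pi) := by gcongr
    have h5 : R / K * A = 1 / K * R + H * (R / K + 2 * ρ / Real.pi) + 1 / K * R := by
      simp only [A, ρ]
      field_simp
      ring
    linarith
  have hpoint : ∀ l ∈ s, 2 * D ≤ ∑ j ∈ Finset.Icc (-((K : ℤ) + n)) (K + n),
      posLog (ρ / ‖l - c j‖) := by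
    intro l hl
    obtain ⟨hl0, hl1, hl2⟩ := hs l hl
    rw [Complex.div_ofReal_re, abs_div, abs_of_pos hR0, div_le_one hR0] at hl1
    rw [Complex.div_ofReal_im, abs_div, abs_of_pos hR0, div_le_iff₀ hR0] at hl2
    refine le_sum_posLog hK0 hR0 c hc hl1 (hl2.trans (le_of_eq (by ring))) fun j hj h => ?_
    exact hc2 j hj (h ▸ hl0)
  -- Double counting: every zero receives at least `2D` from the centres, and every centre gives at
  -- most `(R/K)A`.
  have htotal : (s.card : ℝ) * (2 * D) ≤ (2 * (K + n) + 1) * (R / K * A) := by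
    calc (s.card : ℝ) * (2 * D) ≤ ∑ l ∈ s, ∑ j ∈ Finset.Icc (-((K : ℤ) + n)) (K + n),
        posLog (ρ / ‖l - c j‖) := by
          rw [← nsmul_eq_mul]
          exact Finset.card_nsmul_le_sum _ _ _ hpoint
      _ = ∑ j ∈ Finset.Icc (-((K : ℤ) + n)) (K + n), ∑ l ∈ s, posLog (ρ / ‖l - c j‖) :=
          Finset.sum_comm
      _ ≤ (Finset.Icc (-((K : ℤ) + n)) (K + n)).card • (R / K * A) :=
          Finset.sum_le_card_nsmul _ _ _ hcenter
      _ = _ := by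
          rw [nsmul_eq_mul, Int.card_Icc]
          have : ((K : ℤ) + n + 1 - -((K : ℤ) + n)).toNat = 2 * (K + n) + 1 := by omega
          rw [this]
          push_cast
          ring
  have h6 : (2 * ((K : ℝ) + n) + 1) * A ≤ K * ((2 * H / Real.pi + ε) * (2 * D)) := by
    nlinarith [mul_lt_mul_of_pos_left hn hKr]
  have h7 : (s.card : ℝ) * (2 * D) ≤ ((2 * H / Real.pi + ε) * R) * (2 * D) := by
    refine htotal.trans ?_
    have e1 : (2 * ((K : ℝ) + n) + 1) * (R / K * A) = ((2 * ((K : ℝ) + n) + 1) * A) * (R / K) := by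
      ring
    have e2 : ((2 * H / Real.pi + ε) * R) * (2 * D)
        = K * ((2 * H / Real.pi + ε) * (2 * D)) * (R / K) := by
      field_simp
    rw [e1, e2]
    gcongr
  exact le_of_mul_le_mul_right h7 (by positivity)

end Strip

theorem ScaledCountLE.mono_zeros {Z Z' A : Set ℂ} {d : ℝ} (h : ScaledCountLE Z A d)
    (hZ : Z' ⊆ Z) : ScaledCountLE Z' A d :=
  Filter.Eventually.mono h fun _ hR s hs => hR s fun l hl => ⟨hZ (hs l hl).1, (hs l hl).2⟩

/-! ### Optimal exponential types. -/

section Optimal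
variable {T : ℂ → ℂ}

theorem exists_im_pos_ne_zero (hT : Differentiable ℂ T) (hne : ∃ z, T z ≠ 0) :
    ∃ z : ℂ, 0 < z.im ∧ T z ≠ 0 := by
  by_contra! h
  obtain ⟨z₁, hz₁⟩ := hne
  have han : AnalyticOnNhd ℂ T univ := hT.differentiableOn.analyticOnNhd isOpen_univ
  have ho : IsOpen {z : ℂ | 0 < z.im} := isOpen_lt continuous_const Complex.continuous_im
  have : T =ᶠ[nhds Complex.I] 0 := by
    filter_upwards [ho.mem_nhds (show (0 : ℝ) < Complex.I.im by simp)] with z hz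
    exact h z hz
  exact hz₁ (han.eqOn_zero_of_preconnected_of_eventuallyEq_zero isPreconnected_univ
    (mem_univ Complex.I) this (mem_univ z₁))

/-- `z + i` replaces `1 + |z|` up to a factor `2` and is zero-free for `Im z > -1`, so dividing by
`(z + i)²` keeps the quotient holomorphic. -/
theorem norm_add_I_bounds {z : ℂ} (hz : 0 ≤ z.im) : 1 ≤ ‖z + Complex.I‖ ∧
    1 + ‖z‖ ≤ 2 * ‖z + Complex.I‖ ∧ ‖z + Complex.I‖ ≤ 1 + ‖z‖ := by
  have h1 : 1 ≤ ‖z + Complex.I‖ := by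
    have := (le_abs_self _).trans (Complex.abs_im_le_norm (z + Complex.I))
    simp at this
    linarith
  have h2 : ‖z‖ ≤ ‖z + Complex.I‖ := by
    apply le_of_sq_le_sq _ (norm_nonneg _)
    rw [← Complex.normSq_eq_norm_sq, ← Complex.normSq_eq_norm_sq, Complex.normSq_apply,
      Complex.normSq_apply]
    simp
    nlinarith
  refine ⟨h1, by linarith, ?_⟩
  have := norm_add_le z Complex.I
  rw [Complex.norm_I] at this
  linarith

/-- The smallest exponential type admissible in the upper half-plane. -/
theorem exists_optimal_type (hT : Differentiable ℂ T) (hne : ∃ z, T z ≠ 0) {C h : ℝ} (hC : 0 < C)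
    (hUp : ∀ z : ℂ, 0 ≤ z.im → ‖T z‖ ≤ C * ‖z + Complex.I‖ ^ 2 * Real.exp (h * z.im)) :
    ∃ k ≤ h, (∀ z : ℂ, 0 ≤ z.im → ‖T z‖ ≤ C * ‖z + Complex.I‖ ^ 2 * Real.exp (k * z.im)) ∧
      ∀ ε : ℝ, 0 < ε → ∃ z : ℂ, 0 < z.im ∧
        C * ‖z + Complex.I‖ ^ 2 * Real.exp ((k - ε) * z.im) < ‖T z‖ := by
  -- On the real axis the bound does not depend on `k`, so only `Im z > 0` is asked. The set is
  -- closed, and a single point with `T ≠ 0` bounds it below, so its infimum is attained.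
  set A : Set ℝ := {k | ∀ z : ℂ, 0 < z.im → ‖T z‖ ≤ C * ‖z + Complex.I‖ ^ 2 * Real.exp (k * z.im)}
  have hA : h ∈ A := fun z hz => hUp z hz.le
  obtain ⟨z₁, hz₁, hTz₁⟩ := exists_im_pos_ne_zero hT hne
  have hX : 0 < C * ‖z₁ + Complex.I‖ ^ 2 := by
    have := (norm_add_I_bounds hz₁.le).1
    positivity
  have hbdd : BddBelow A := by
    refine ⟨Real.log (‖T z₁‖ / (C * ‖z₁ + Complex.I‖ ^ 2)) / z₁.im, fun k hk => ?_⟩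
    rw [div_le_iff₀ hz₁, Real.log_le_iff_le_exp (div_pos (norm_pos_iff.2 hTz₁) hX),
      div_le_iff₀' hX]
    exact hk z₁ hz₁
  have hcl : IsClosed A := by
    have : A = ⋂ z : ℂ, ⋂ _ : 0 < z.im,
        {k | ‖T z‖ ≤ C * ‖z + Complex.I‖ ^ 2 * Real.exp (k * z.im)} := by
      ext k
      simp [A]
    rw [this]
    exact isClosed_iInter fun z => isClosed_iInter fun _ => isClosed_le continuous_const
      (by fun_prop)
  have hmem := hcl.csInf_mem ⟨h, hA⟩ hbdd
  refine ⟨sInf A, csInf_le hbdd hA, fun z hz => ?_, fun ε hε => ?_⟩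
  · rcases eq_or_lt_of_le hz with h0 | h0
    · simpa [← h0] using hUp z hz
    · exact hmem z h0
  · by_contra! hcon
    have : sInf A - ε ∈ A := hcon
    have := csInf_le hbdd this
    linarith

/-- The normalised function `T(z) e^{ikz} / (C (z + i)²)`. -/
noncomputable def halfPlaneQuotient (T : ℂ → ℂ) (C k : ℝ) (z : ℂ) : ℂ :=
  T z * Complex.exp (Complex.I * k * z) / (C * (z + Complex.I) ^ 2)

theorem norm_exp_I_mul (k : ℝ) (z : ℂ) :
    ‖Complex.exp (Complex.I * k * z)‖ = Real.exp (-(k * z.im)) := by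
  rw [Complex.norm_exp]
  simp

theorem norm_halfPlaneQuotient {C k : ℝ} (hC : 0 < C) (z : ℂ) :
    ‖halfPlaneQuotient T C k z‖ = ‖T z‖ * Real.exp (-(k * z.im)) / (C * ‖z + Complex.I‖ ^ 2) := by
  rw [halfPlaneQuotient, norm_div, norm_mul, norm_exp_I_mul, norm_mul, norm_pow, Complex.norm_real,
    Real.norm_of_nonneg hC.le]

theorem differentiableOn_halfPlaneQuotient (hT : Differentiable ℂ T) {C k : ℝ} (hC : 0 < C) :
    DifferentiableOn ℂ (halfPlaneQuotient T C k) {z | -1 < z.im} := by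
  apply DifferentiableOn.div
  · exact (hT.mul (by fun_prop)).differentiableOn
  · fun_prop
  · intro z hz h
    have hC' : (C : ℂ) ≠ 0 := by exact_mod_cast hC.ne'
    have h0 : z + Complex.I = 0 := by simpa [hC'] using h
    have := congrArg Complex.im h0
    have hz' : -1 < z.im := hz
    simp at this
    linarith

theorem norm_halfPlaneQuotient_le_one {C k : ℝ} (hC : 0 < C) {z : ℂ} (hz : 0 ≤ z.im)
    (h : ‖T z‖ ≤ C * ‖z + Complex.I‖ ^ 2 * Real.exp (k * z.im)) :
    ‖halfPlaneQuotient T C k z‖ ≤ 1 := by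
  have := (norm_add_I_bounds hz).1
  rw [norm_halfPlaneQuotient hC, div_le_one (by positivity), Real.exp_neg,
    mul_inv_le_iff₀ (Real.exp_pos _)]
  exact h

theorem lt_norm_halfPlaneQuotient {C k ε : ℝ} (hC : 0 < C) {z : ℂ} (hz : 0 < z.im)
    (h : C * ‖z + Complex.I‖ ^ 2 * Real.exp ((k - ε) * z.im) < ‖T z‖) :
    Real.exp (-(ε * z.im)) < ‖halfPlaneQuotient T C k z‖ := by
  have := (norm_add_I_bounds hz.le).1
  rw [norm_halfPlaneQuotient hC, lt_div_iff₀ (by positivity), Real.exp_neg (k * z.im),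
    ← div_eq_mul_inv, lt_div_iff₀ (Real.exp_pos _)]
  refine lt_of_eq_of_lt ?_ h
  rw [mul_right_comm, ← Real.exp_add, mul_comm]
  ring_nf

theorem halfPlaneQuotient_of_eq_zero {C k : ℝ} {z : ℂ} (h : T z = 0) :
    halfPlaneQuotient T C k z = 0 := by simp [halfPlaneQuotient, h]

end Optimal

/-! ### The zero count in a disc. -/

/-- Upper bound for the number of zeros of an entire function with given exponential types in the
upper and lower half-planes and polynomial growth along the real axis. -/
theorem scaledCountLE_zeros {T : ℂ → ℂ} (hT : Differentiable ℂ T) (hne : ∃ z, T z ≠ 0)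
    {C h₁ h₂ : ℝ} (hC : 1 ≤ C)
    (hUp : ∀ z : ℂ, 0 ≤ z.im → ‖T z‖ ≤ C * (1 + ‖z‖) ^ 2 * Real.exp (h₁ * z.im))
    (hLow : ∀ z : ℂ, z.im ≤ 0 → ‖T z‖ ≤ C * (1 + ‖z‖) ^ 2 * Real.exp (-(h₂ * z.im)))
    {ε : ℝ} (hε : 0 < ε) :
    ScaledCountLE {z | T z = 0} (Metric.closedBall 0 1) (max (h₁ + h₂) 0 / Real.pi + ε) := by
  have hpi := Real.pi_pos
  have hC4 : 0 < 4 * C := by linarith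
  have hstep : ∀ z : ℂ, 0 ≤ z.im → C * (1 + ‖z‖) ^ 2 ≤ 4 * C * ‖z + Complex.I‖ ^ 2 := by
    intro z hz
    have h1 := (norm_add_I_bounds hz).2.1
    have h2 : (1 + ‖z‖) ^ 2 ≤ (2 * ‖z + Complex.I‖) ^ 2 := by gcongr
    nlinarith
  set T' : ℂ → ℂ := fun z => T (-z)
  have hT' : Differentiable ℂ T' := hT.comp differentiable_neg
  have hne' : ∃ z, T' z ≠ 0 := by
    obtain ⟨z, hz⟩ := hne
    exact ⟨-z, by simpa [T'] using hz⟩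
  obtain ⟨k₁, hk₁, hk₁b, hk₁o⟩ := exists_optimal_type hT hne (h := h₁) hC4 fun z hz =>
    (hUp z hz).trans (mul_le_mul_of_nonneg_right (hstep z hz) (Real.exp_pos _).le)
  obtain ⟨k₂, hk₂, hk₂b, hk₂o⟩ := exists_optimal_type hT' hne' (h := h₂) hC4 fun z hz => by
    have := hLow (-z) (by simpa using hz)
    rw [norm_neg, Complex.neg_im, mul_neg, neg_neg] at this
    exact this.trans (mul_le_mul_of_nonneg_right (hstep z hz) (Real.exp_pos _).le)
  set Q₁ := halfPlaneQuotient T (4 * C) k₁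
  set Q₂ := halfPlaneQuotient T' (4 * C) k₂
  have hQ₁d : DifferentiableOn ℂ Q₁ {z | -1 < z.im} := differentiableOn_halfPlaneQuotient hT hC4
  have hQ₂d : DifferentiableOn ℂ Q₂ {z | -1 < z.im} := differentiableOn_halfPlaneQuotient hT' hC4
  have hQ₁b : ∀ z : ℂ, 0 ≤ z.im → ‖Q₁ z‖ ≤ 1 := fun z hz =>
    norm_halfPlaneQuotient_le_one hC4 hz (hk₁b z hz)
  have hQ₂b : ∀ z : ℂ, 0 ≤ z.im → ‖Q₂ z‖ ≤ 1 := fun z hz =>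
    norm_halfPlaneQuotient_le_one hC4 hz (hk₂b z hz)
  have hQ₁o : ∀ ε : ℝ, 0 < ε → ∃ z : ℂ, 0 < z.im ∧ Real.exp (-(ε * z.im)) < ‖Q₁ z‖ := by
    intro ε hε
    obtain ⟨z, hz, h⟩ := hk₁o ε hε
    exact ⟨z, hz, lt_norm_halfPlaneQuotient hC4 hz h⟩
  have hQ₂o : ∀ ε : ℝ, 0 < ε → ∃ z : ℂ, 0 < z.im ∧ Real.exp (-(ε * z.im)) < ‖Q₂ z‖ := by
    intro ε hε
    obtain ⟨z, hz, h⟩ := hk₂o ε hε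
    exact ⟨z, hz, lt_norm_halfPlaneQuotient hC4 hz h⟩
  -- Multiplying by `e^{iαz}` balances the two types to their mean `h` and moves no zero. `H`
  -- replaces `h` because the mean may be negative.
  set α : ℝ := (k₁ - k₂) / 2 with hα
  set h : ℝ := (k₁ + k₂) / 2 with hh
  set H : ℝ := max h 0
  set F : ℂ → ℂ := fun z => T z * Complex.exp (Complex.I * α * z)
  have hFd : Differentiable ℂ F := hT.mul (by fun_prop)
  have hF0 : ∀ z, F z = 0 ↔ T z = 0 := fun z => by simp [F]
  have hFn : ∀ z, ‖F z‖ = ‖T z‖ * Real.exp (-(α * z.im)) := fun z => by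
    rw [norm_mul, norm_exp_I_mul]
  have hFb : ∀ z, ‖F z‖ ≤ 4 * C * (1 + ‖z‖) ^ 2 * Real.exp (H * |z.im|) := by
    intro z
    rw [hFn]
    have hHh : h ≤ H := le_max_left _ _
    rcases le_total 0 z.im with hz | hz
    · calc ‖T z‖ * Real.exp (-(α * z.im))
          ≤ 4 * C * (1 + ‖z‖) ^ 2 * Real.exp (k₁ * z.im) * Real.exp (-(α * z.im)) := by
            gcongr
            refine (hk₁b z hz).trans ?_
            gcongr
            exact (norm_add_I_bounds hz).2.2
        _ = 4 * C * (1 + ‖z‖) ^ 2 * Real.exp (h * z.im) := by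
            rw [mul_assoc, ← Real.exp_add]
            congr 2
            rw [hα, hh]
            ring
        _ ≤ _ := by
            rw [abs_of_nonneg hz]
            gcongr
    · have hz' : 0 ≤ (-z).im := by simpa using hz
      have hT2 := hk₂b (-z) hz'
      simp only [T', neg_neg, Complex.neg_im] at hT2
      have hn := (norm_add_I_bounds hz').2.2
      rw [norm_neg] at hn
      calc ‖T z‖ * Real.exp (-(α * z.im))
          ≤ 4 * C * (1 + ‖z‖) ^ 2 * Real.exp (k₂ * -z.im) * Real.exp (-(α * z.im)) := by
            gcongr
            refine hT2.trans ?_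
            gcongr
        _ = 4 * C * (1 + ‖z‖) ^ 2 * Real.exp (h * -z.im) := by
            rw [mul_assoc, ← Real.exp_add]
            congr 2
            rw [hα, hh]
            ring
        _ ≤ _ := by
            rw [abs_of_nonpos hz]
            have : 0 ≤ -z.im := by linarith
            gcongr
  have hgood : ∀ x δ κ : ℝ, 0 < δ → 0 < κ → ∀ᶠ R : ℝ in atTop,
      ∃ z : ℂ, ‖z - ((R * x : ℝ) : ℂ)‖ ≤ δ * R ∧ F z ≠ 0 ∧ -(κ * R) ≤ Real.log ‖F z‖ := by
    intro x δ κ hδ hκ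
    -- The search is made around height `ηR` above `Rx`: low enough to stay within `δR`, and such
    -- that `e^{h Im z}` costs at most `e^{-κR/2}`.
    set η : ℝ := min (δ / 2) (κ / (4 * (|h| + 1)))
    have hη : 0 < η := lt_min (by positivity) (by positivity)
    have hη1 : η ≤ δ / 2 := min_le_left _ _
    have hη2 : η ≤ κ / (4 * (|h| + 1)) := min_le_right _ _
    rw [le_div_iff₀ (by positivity)] at hη2
    set c : ℂ := ⟨x, η⟩
    have hci : c.im = η := rfl
    filter_upwards [eventually_exists_norm_gt hQ₁d hQ₁b hQ₁o (c := c) (δ := η / 2) (κ := κ / 2)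
      (by positivity) (by rw [hci]; linarith) (by positivity), eventually_gt_atTop 0] with R hR hR0
    obtain ⟨z, hz, hQz⟩ := hR
    have him := (Complex.abs_im_le_norm _).trans hz
    have hRc : ((R : ℂ) * c).im = R * η := by simp [c]
    rw [Complex.sub_im, hRc, abs_le] at him
    have hzpos : 0 < z.im := by nlinarith
    have hzle : z.im ≤ 2 * η * R := by nlinarith
    rw [norm_halfPlaneQuotient hC4] at hQz
    have hI := (norm_add_I_bounds hzpos.le).1
    rw [lt_div_iff₀ (by positivity)] at hQz
    have hlow : Real.exp (-(κ * R)) ≤ ‖F z‖ := by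
      have h1 : Real.exp (-(κ / 2 * R)) ≤ Real.exp (-(κ / 2 * R)) * (4 * C * ‖z + Complex.I‖ ^ 2) :=
        le_mul_of_one_le_right (Real.exp_pos _).le
          (one_le_mul_of_one_le_of_one_le (by linarith) (one_le_pow₀ hI))
      have h2 : Real.exp (-(κ / 2 * R)) ≤ ‖T z‖ * Real.exp (-(k₁ * z.im)) := h1.trans hQz.le
      have h3 : ‖F z‖ = ‖T z‖ * Real.exp (-(k₁ * z.im)) * Real.exp (h * z.im) := by
        rw [hFn, mul_assoc, ← Real.exp_add]
        congr 2
        rw [hα, hh]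
        ring
      rw [h3]
      have h4 : -(κ / 2 * R) ≤ h * z.im := by
        have h5 : -(|h| * z.im) ≤ h * z.im := by
          have := neg_abs_le h
          nlinarith
        have h6 : |h| * z.im ≤ (|h| + 1) * (2 * η * R) := by
          have := abs_nonneg h
          nlinarith
        nlinarith
      calc Real.exp (-(κ * R)) = Real.exp (-(κ / 2 * R)) * Real.exp (-(κ / 2 * R)) := by
            rw [← Real.exp_add]
            ring_nf
        _ ≤ _ := by gcongr
    have hFz : 0 < ‖F z‖ := (Real.exp_pos _).trans_le hlow
    refine ⟨z, ?_, norm_pos_iff.1 hFz, ?_⟩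
    · have e : z - ((R * x : ℝ) : ℂ) = (z - R * c) + R * (c - x) := by
        push_cast
        ring
      have e2 : c - x = η * Complex.I := by
        apply Complex.ext <;> simp [c]
      rw [e]
      refine (norm_add_le _ _).trans ?_
      rw [e2, norm_mul, norm_mul, Complex.norm_real, Complex.norm_real, Complex.norm_I,
        Real.norm_of_nonneg hR0.le, Real.norm_of_nonneg hη.le]
      nlinarith
    · rwa [Real.le_log_iff_exp_le hFz]
  obtain ⟨τ, hτ, hstrip⟩ := exists_strip_scaledCountLE hFd (C := 4 * C) (by linarith)
    (le_max_right h 0) hFb hgood (ε := ε / 3) (by positivity)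
  set K : Set ℂ := Metric.closedBall 0 1 ∩ {z : ℂ | τ ≤ z.im}
  have hK : IsCompact K := (isCompact_closedBall _ _).inter_right
    (isClosed_le continuous_const Complex.continuous_im)
  have hKpos : ∀ z ∈ K, 0 < z.im := fun z hz => hτ.trans_le hz.2
  have hU := (scaledCountLE_of_isCompact hQ₁d hQ₁b hQ₁o hK hKpos (ε / 3)
    (by positivity)).mono_zeros (Z' := {z | T z = 0}) fun z hz => halfPlaneQuotient_of_eq_zero hz
  have hL := (scaledCountLE_of_isCompact hQ₂d hQ₂b hQ₂o hK hKpos (ε / 3)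
    (by positivity)).neg.mono_zeros (Z' := {z | T z = 0}) fun z hz => by
      refine halfPlaneQuotient_of_eq_zero ?_
      show T (- -z) = 0
      rw [neg_neg]
      exact hz
  have hS := hstrip.mono_zeros (Z' := {z | T z = 0}) fun z hz => (hF0 z).2 hz
  have hall := (hS.union hU).union hL
  -- The disc is covered by the strip, `K` and `-K`, each contributing an error of `ε/3`.
  have hsub : Metric.closedBall (0 : ℂ) 1 ⊆
      ({z | |z.re| ≤ 1 ∧ |z.im| ≤ τ} ∪ K) ∪ {z | -z ∈ K} := by
    intro z hz
    have hz1 : ‖z‖ ≤ 1 := by simpa using hz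
    rcases le_total τ z.im with h1 | h1
    · exact Or.inl (Or.inr ⟨hz, h1⟩)
    · rcases le_total τ (-z.im) with h2 | h2
      · exact Or.inr ⟨by simpa using hz1, by simpa using h2⟩
      · exact Or.inl (Or.inl ⟨(Complex.abs_re_le_norm z).trans hz1, abs_le.2 ⟨by linarith, h1⟩⟩)
  have hfin := hall.mono hsub
  have hd : 2 * H / Real.pi + ε / 3 + ε / 3 + ε / 3 ≤ max (h₁ + h₂) 0 / Real.pi + ε := by
    have : 2 * H ≤ max (h₁ + h₂) 0 := by
      rcases max_cases h 0 with ⟨h3, _⟩ | ⟨h3, _⟩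
      · have : H = h := h3
        rw [this]
        exact le_trans (by linarith) (le_max_left _ _)
      · have : H = 0 := h3
        rw [this, mul_zero]
        exact le_max_right _ _
    have h4 : 2 * H / Real.pi ≤ max (h₁ + h₂) 0 / Real.pi := by gcongr
    linarith
  filter_upwards [hfin, eventually_ge_atTop 0] with R hR hR0 s hs
  exact (hR s hs).trans (by gcongr)

/-! ### Phragmén–Lindelöf in sectors. -/

section Sector
variable {G : ℂ → ℂ}

/-- Phragmén–Lindelöf in a sector of the upper half-plane, for the product of a bounded function
and an exponential. -/
theorem norm_mul_exp_le_of_sector (hG : DifferentiableOn ℂ G {z | -1 < z.im})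
    (hG1 : ∀ z : ℂ, 0 ≤ z.im → ‖G z‖ ≤ 1) {α β : ℝ} (hα : 0 ≤ α) (hβ : β ≤ Real.pi) (hαβ : α < β)
    (hop : β - α < Real.pi) {w : ℂ} {C : ℝ}
    (h1 : ∀ r : ℝ, 0 < r → ‖G (r * Complex.exp (α * Complex.I))
      * Complex.exp (w * (r * Complex.exp (α * Complex.I)))‖ ≤ C)
    (h2 : ∀ r : ℝ, 0 < r → ‖G (r * Complex.exp (β * Complex.I))
      * Complex.exp (w * (r * Complex.exp (β * Complex.I)))‖ ≤ C)
    {r θ : ℝ} (hr : 0 < r) (hθ1 : α ≤ θ) (hθ2 : θ ≤ β) :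
    ‖G (r * Complex.exp (θ * Complex.I))
      * Complex.exp (w * (r * Complex.exp (θ * Complex.I)))‖ ≤ C := by
  -- The exponential maps the strip `α < Im ζ < β` onto the sector.
  set f : ℂ → ℂ := fun ζ => G (Complex.exp ζ) * Complex.exp (w * Complex.exp ζ)
  have hexp : ∀ ζ : ℂ, Complex.exp ζ = ((Real.exp ζ.re : ℝ) : ℂ) * Complex.exp (ζ.im * Complex.I) :=
    fun ζ => by
      rw [Complex.ofReal_exp, ← Complex.exp_add, Complex.re_add_im]
  have him : ∀ ζ : ℂ, α ≤ ζ.im → ζ.im ≤ β → 0 ≤ (Complex.exp ζ).im := fun ζ ha hb => by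
    rw [Complex.exp_im]
    exact mul_nonneg (Real.exp_pos _).le (Real.sin_nonneg_of_nonneg_of_le_pi (hα.trans ha)
      (hb.trans hβ))
  have hcl : closure (Complex.im ⁻¹' Ioo α β) ⊆ Complex.im ⁻¹' Icc α β :=
    closure_minimal (preimage_mono Ioo_subset_Icc_self) (isClosed_Icc.preimage Complex.continuous_im)
  have hfd : DiffContOnCl ℂ f (Complex.im ⁻¹' Ioo α β) := by
    apply DifferentiableOn.diffContOnCl
    refine DifferentiableOn.mul (hG.comp Complex.differentiable_exp.differentiableOn ?_)
      (Differentiable.differentiableOn (by fun_prop))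
    intro ζ hζ
    have := him ζ (hcl hζ).1 (hcl hζ).2
    show -1 < (Complex.exp ζ).im
    linarith
  have hgrowth : ∃ c < Real.pi / (β - α), ∃ B, f =O[comap (_root_.abs ∘ Complex.re) atTop ⊓
      𝓟 (Complex.im ⁻¹' Ioo α β)] fun z => Real.exp (B * Real.exp (c * |z.re|)) := by
    -- `f` grows at most like `exp(‖w‖ e^{|Re ζ|})`, and the exponent `1` is admissible because the
    -- opening is less than `π`.
    refine ⟨1, by rw [lt_div_iff₀ (by linarith)]; linarith, ‖w‖, ?_⟩
    refine Asymptotics.IsBigO.of_bound 1 (Filter.mem_inf_of_right ?_)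
    intro ζ hζ
    rw [mem_preimage, mem_Ioo] at hζ
    show ‖f ζ‖ ≤ 1 * ‖Real.exp (‖w‖ * Real.exp (1 * |ζ.re|))‖
    rw [one_mul, one_mul, Real.norm_of_nonneg (Real.exp_pos _).le, norm_mul]
    calc ‖G (Complex.exp ζ)‖ * ‖Complex.exp (w * Complex.exp ζ)‖
        ≤ 1 * Real.exp ‖w * Complex.exp ζ‖ := by
          gcongr
          · exact hG1 _ (him ζ hζ.1.le hζ.2.le)
          · exact Complex.norm_exp_le_exp_norm _
      _ ≤ _ := by
          rw [one_mul, norm_mul, Complex.norm_exp]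
          gcongr
          exact le_abs_self _
  have key := PhragmenLindelof.horizontal_strip (f := f) (C := C) (z := Real.log r + θ * Complex.I)
    hfd hgrowth (fun ζ hζ => ?_) (fun ζ hζ => ?_) (by simpa using hθ1) (by simpa using hθ2)
  · have e : Complex.exp (Real.log r + θ * Complex.I) = r * Complex.exp (θ * Complex.I) := by
      rw [Complex.exp_add, ← Complex.ofReal_exp, Real.exp_log hr]
    simp only [f, e] at key
    exact key
  · simp only [f]
    rw [hexp ζ, hζ]
    exact h1 _ (Real.exp_pos _)
  · simp only [f]
    rw [hexp ζ, hζ]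
    exact h2 _ (Real.exp_pos _)

theorem im_mul_exp (r θ : ℝ) : ((r : ℂ) * Complex.exp (θ * Complex.I)).im = r * Real.sin θ := by
  rw [Complex.mul_im, Complex.ofReal_re, Complex.ofReal_im, Complex.exp_ofReal_mul_I_im]
  ring

theorem re_mul_exp (r θ : ℝ) : ((r : ℂ) * Complex.exp (θ * Complex.I)).re = r * Real.cos θ := by
  rw [Complex.mul_re, Complex.ofReal_re, Complex.ofReal_im, Complex.exp_ofReal_mul_I_re]
  ring

theorem norm_mul_cexp_ofReal_mul (a b : ℂ) (t : ℝ) :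
    ‖a * Complex.exp (t * b)‖ = ‖a‖ * Real.exp (t * b.re) := by
  rw [norm_mul, Complex.norm_exp]
  simp

theorem norm_mul_cexp_neg_I_mul (a b : ℂ) (t : ℝ) :
    ‖a * Complex.exp (-(Complex.I * t) * b)‖ = ‖a‖ * Real.exp (t * b.im) := by
  rw [norm_mul, Complex.norm_exp]
  simp

/-- Exponential decay along a ray inside the upper half-plane forces exponential decay in the whole
half-plane. -/
theorem decay_of_decay_on_interior_ray (hG : DifferentiableOn ℂ G {z | -1 < z.im})
    (hG1 : ∀ z : ℂ, 0 ≤ z.im → ‖G z‖ ≤ 1) {θ C ε : ℝ} (hθ0 : 0 < θ) (hθπ : θ < Real.pi)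
    (hε : 0 < ε) (hC : 1 ≤ C)
    (h : ∀ r : ℝ, 0 < r → ‖G (r * Complex.exp (θ * Complex.I))‖ ≤ C * Real.exp (-(ε * r)))
    {z : ℂ} (hz : 0 ≤ z.im) : ‖G z‖ ≤ C * Real.exp (-(ε * z.im)) := by
  have hpos : ∀ φ r : ℝ, 0 < r → 0 ≤ φ → φ ≤ Real.pi →
      0 ≤ ((r : ℂ) * Complex.exp (φ * Complex.I)).im := fun φ r hr h0 hπ => by
    rw [im_mul_exp]
    exact mul_nonneg hr.le (Real.sin_nonneg_of_nonneg_of_le_pi h0 hπ)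
  -- The factor `e^{-iεz}` has modulus `e^{ε Im z}`: it is compensated by the decay on the ray, as
  -- `Im z ≤ r`, and is unimodular on the real axis. The two sectors cut out by the ray both have
  -- opening less than `π`.
  have hray : ∀ r : ℝ, 0 < r → ‖G (r * Complex.exp (θ * Complex.I))
      * Complex.exp (-(Complex.I * ε) * (r * Complex.exp (θ * Complex.I)))‖ ≤ C := by
    intro r hr
    rw [norm_mul_cexp_neg_I_mul, im_mul_exp]
    have h1 := h r hr
    have h2 : Real.exp (ε * (r * Real.sin θ)) ≤ Real.exp (ε * r) := by
      gcongr
      have := Real.sin_le_one θ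
      nlinarith
    calc _ ≤ C * Real.exp (-(ε * r)) * Real.exp (ε * r) := by gcongr
      _ = C := by rw [mul_assoc, ← Real.exp_add]; simp
  have hbd : ∀ φ : ℝ, 0 ≤ φ → φ ≤ Real.pi → Real.sin φ = 0 → ∀ r : ℝ, 0 < r →
      ‖G (r * Complex.exp (φ * Complex.I))
      * Complex.exp (-(Complex.I * ε) * (r * Complex.exp (φ * Complex.I)))‖ ≤ C := by
    intro φ h0 hπ hs r hr
    rw [norm_mul_cexp_neg_I_mul, im_mul_exp, hs, mul_zero, mul_zero, Real.exp_zero, mul_one]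
    exact (hG1 _ (hpos φ r hr h0 hπ)).trans hC
  rcases eq_or_ne z 0 with rfl | hz0
  · simpa using (hG1 0 (by simp)).trans hC
  have harg0 : 0 ≤ z.arg := Complex.arg_nonneg_iff.2 hz
  have hargπ : z.arg ≤ Real.pi := Complex.arg_le_pi z
  have key : ‖G (‖z‖ * Complex.exp (z.arg * Complex.I))
      * Complex.exp (-(Complex.I * ε) * (‖z‖ * Complex.exp (z.arg * Complex.I)))‖ ≤ C := by
    have hzn := norm_pos_iff.2 hz0
    rcases le_total z.arg θ with hle | hle
    · exact norm_mul_exp_le_of_sector hG hG1 le_rfl hθπ.le hθ0 (by linarith)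
        (hbd 0 le_rfl Real.pi_pos.le Real.sin_zero) hray hzn harg0 hle
    · exact norm_mul_exp_le_of_sector hG hG1 hθ0.le le_rfl hθπ (by linarith)
        hray (hbd Real.pi Real.pi_pos.le le_rfl Real.sin_pi) hzn hle hargπ
  rw [Complex.norm_mul_exp_arg_mul_I, norm_mul_cexp_neg_I_mul] at key
  rw [Real.exp_neg, ← div_eq_mul_inv, le_div_iff₀ (Real.exp_pos _)]
  exact key

/-- Exponential decay along a ray of the closed upper half-plane forces exponential decay in the
whole half-plane. -/
theorem decay_of_decay_on_ray (hG : DifferentiableOn ℂ G {z | -1 < z.im})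
    (hG1 : ∀ z : ℂ, 0 ≤ z.im → ‖G z‖ ≤ 1) {θ C ε : ℝ} (hθ0 : 0 ≤ θ) (hθπ : θ ≤ Real.pi)
    (hε : 0 < ε) (hC : 1 ≤ C)
    (h : ∀ r : ℝ, 0 < r → ‖G (r * Complex.exp (θ * Complex.I))‖ ≤ C * Real.exp (-(ε * r))) :
    ∃ ε' : ℝ, 0 < ε' ∧ ∀ z : ℂ, 0 ≤ z.im → ‖G z‖ ≤ C * Real.exp (-(ε' * z.im)) := by
  have hpi := Real.pi_pos
  have hcos : 0 < Real.cos (Real.pi / 4) := Real.cos_pos_of_mem_Ioo ⟨by linarith, by linarith⟩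
  have hmid : ∀ r : ℝ, 0 < r → ∀ t : ℝ, ‖G (r * Complex.exp ((Real.pi / 2 : ℝ) * Complex.I))
      * Complex.exp (t * (r * Complex.exp ((Real.pi / 2 : ℝ) * Complex.I)))‖ ≤ C := by
    intro r hr t
    rw [norm_mul_cexp_ofReal_mul, re_mul_exp, Real.cos_pi_div_two, mul_zero, mul_zero,
      Real.exp_zero, mul_one]
    refine (hG1 _ ?_).trans hC
    rw [im_mul_exp, Real.sin_pi_div_two]
    linarith
  -- For a real ray, `e^{εz}` (or `e^{-εz}` for the negative one) is unimodular on the imaginary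
  -- axis. The quarter-plane estimate yields decay on its bisector, which is an interior ray.
  rcases eq_or_lt_of_le hθ0 with rfl | hθ0
  · refine ⟨ε * Real.cos (Real.pi / 4), by positivity, fun z hz =>
      decay_of_decay_on_interior_ray hG hG1 (θ := Real.pi / 4) (by positivity) (by linarith)
        (by positivity) hC (fun r hr => ?_) hz⟩
    have key := norm_mul_exp_le_of_sector hG hG1 (α := 0) (β := Real.pi / 2) (w := (ε : ℂ))
      (C := C) le_rfl (by linarith) (by linarith) (by linarith) (fun s hs => ?_)
      (fun s hs => hmid s hs ε) (θ := Real.pi / 4) hr (by linarith) (by linarith)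
    · rw [norm_mul_cexp_ofReal_mul, re_mul_exp] at key
      rw [Real.exp_neg, ← div_eq_mul_inv, le_div_iff₀ (Real.exp_pos _)]
      rwa [show ε * Real.cos (Real.pi / 4) * r = ε * (r * Real.cos (Real.pi / 4)) by ring]
    · rw [norm_mul_cexp_ofReal_mul, re_mul_exp, Real.cos_zero, mul_one]
      calc _ ≤ C * Real.exp (-(ε * s)) * Real.exp (ε * s) := by gcongr; exact h s hs
        _ = C := by rw [mul_assoc, ← Real.exp_add]; simp
  · rcases eq_or_lt_of_le hθπ with rfl | hθπ
    · refine ⟨ε * Real.cos (Real.pi / 4), by positivity, fun z hz =>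
        decay_of_decay_on_interior_ray hG hG1 (θ := Real.pi - Real.pi / 4) (by linarith)
          (by linarith) (by positivity) hC (fun r hr => ?_) hz⟩
      have key := norm_mul_exp_le_of_sector hG hG1 (α := Real.pi / 2) (β := Real.pi)
        (w := ((-ε : ℝ) : ℂ)) (C := C) (by linarith) le_rfl (by linarith) (by linarith)
        (fun s hs => hmid s hs (-ε)) (fun s hs => ?_) (θ := Real.pi - Real.pi / 4) hr
        (by linarith) (by linarith)
      · rw [norm_mul_cexp_ofReal_mul, re_mul_exp, Real.cos_pi_sub] at key
        rw [Real.exp_neg, ← div_eq_mul_inv, le_div_iff₀ (Real.exp_pos _)]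
        rwa [show ε * Real.cos (Real.pi / 4) * r = -ε * (r * -Real.cos (Real.pi / 4)) by ring]
      · rw [norm_mul_cexp_ofReal_mul, re_mul_exp, Real.cos_pi]
        calc _ ≤ C * Real.exp (-(ε * s)) * Real.exp (-ε * (s * -1)) := by gcongr; exact h s hs
          _ = C := by rw [mul_assoc, ← Real.exp_add]; simp
    · exact ⟨ε, hε, fun z hz => decay_of_decay_on_interior_ray hG hG1 hθ0 hθπ hε hC h hz⟩

end Sector

/-! ### The indicator of a function with the maximal density of zeros. -/

/-- If the zeros of `T` have the largest density that the growth of `T` allows, then `T` does not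
decay exponentially along any ray of the closed upper half-plane. -/
theorem not_decay_on_ray {T : ℂ → ℂ} (hT : Differentiable ℂ T) (hne : ∃ z, T z ≠ 0)
    {C L : ℝ} (hC : 1 ≤ C) (hL : 0 < L)
    (hUp : ∀ z : ℂ, 0 ≤ z.im → ‖T z‖ ≤ C * (1 + ‖z‖) ^ 2)
    (hLow : ∀ z : ℂ, z.im ≤ 0 → ‖T z‖ ≤ C * (1 + ‖z‖) ^ 2 * Real.exp (-(L * z.im)))
    (hdens : ∀ d : ℝ, 0 ≤ d → ScaledCountLE {z | T z = 0} (Metric.closedBall 0 1) d →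
      L / Real.pi ≤ d)
    {θ ε : ℝ} (hθ0 : 0 ≤ θ) (hθπ : θ ≤ Real.pi) (hε : 0 < ε) :
    ¬ ∀ᶠ r : ℝ in atTop, ‖T (r * Complex.exp (θ * Complex.I))‖ ≤ Real.exp (-(ε * r)) := by
  intro hev
  have hpi := Real.pi_pos
  have hC4 : 0 < 4 * C := by linarith
  obtain ⟨r₀, hr₀⟩ := eventually_atTop.1 hev
  set G := halfPlaneQuotient T (4 * C) 0
  have hGd : DifferentiableOn ℂ G {z | -1 < z.im} := differentiableOn_halfPlaneQuotient hT hC4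
  have hG1 : ∀ z : ℂ, 0 ≤ z.im → ‖G z‖ ≤ 1 := fun z hz => by
    refine norm_halfPlaneQuotient_le_one hC4 hz ((hUp z hz).trans ?_)
    rw [zero_mul, Real.exp_zero, mul_one]
    have h1 := (norm_add_I_bounds hz).2.1
    have h2 : (1 + ‖z‖) ^ 2 ≤ (2 * ‖z + Complex.I‖) ^ 2 := by gcongr
    nlinarith
  have hGn : ∀ z, ‖G z‖ = ‖T z‖ / (4 * C * ‖z + Complex.I‖ ^ 2) := fun z => by
    rw [norm_halfPlaneQuotient hC4]
    simp
  obtain ⟨ε', hε', hdec⟩ := decay_of_decay_on_ray hGd hG1 (C := Real.exp (ε * max r₀ 0)) hθ0 hθπ hε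
    (Real.one_le_exp (by positivity)) fun r hr => by
      have hz : 0 ≤ ((r : ℂ) * Complex.exp (θ * Complex.I)).im := by
        rw [im_mul_exp]
        exact mul_nonneg hr.le (Real.sin_nonneg_of_nonneg_of_le_pi hθ0 hθπ)
      rcases le_total r₀ r with h | h
      · have h1 : ‖G (r * Complex.exp (θ * Complex.I))‖ ≤ Real.exp (-(ε * r)) := by
          rw [hGn]
          refine (div_le_self (norm_nonneg _) ?_).trans (hr₀ r h)
          exact one_le_mul_of_one_le_of_one_le (by linarith)
            (one_le_pow₀ (norm_add_I_bounds hz).1)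
        refine h1.trans (le_mul_of_one_le_left (Real.exp_pos _).le ?_)
        exact Real.one_le_exp (by positivity)
      · refine (hG1 _ hz).trans ?_
        rw [← Real.exp_add]
        apply Real.one_le_exp
        have : r ≤ max r₀ 0 := h.trans (le_max_left _ _)
        nlinarith
  set C' := Real.exp (ε * max r₀ 0)
  have hC' : 1 ≤ C' := Real.one_le_exp (by positivity)
  -- The tolerance keeps the resulting density below `L/π` both when `ε' ≤ L` and when the sum of
  -- the types is negative.
  have hcount := scaledCountLE_zeros hT hne (C := 4 * C * C') (h₁ := -ε') (h₂ := L)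
    (one_le_mul_of_one_le_of_one_le (by linarith) hC') (fun z hz => ?_) (fun z hz => ?_)
    (ε := min ε' L / (2 * Real.pi)) (by positivity)
  · have h1 := hdens _ (by positivity) hcount
    have h2 : max (-ε' + L) 0 / Real.pi + min ε' L / (2 * Real.pi)
        = (max (-ε' + L) 0 + min ε' L / 2) / Real.pi := by field_simp
    rw [h2, div_le_div_iff_of_pos_right hpi] at h1
    rcases le_total ε' L with h | h
    · rw [max_eq_left (by linarith), min_eq_left h] at h1
      linarith
    · rw [max_eq_right (by linarith), min_eq_right h] at h1
      linarith
  · have h1 := hdec z hz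
    have hI := norm_add_I_bounds hz
    rw [hGn, div_le_iff₀ (by nlinarith [hI.1])] at h1
    refine h1.trans ?_
    rw [neg_mul]
    have h3 : ‖z + Complex.I‖ ^ 2 ≤ (1 + ‖z‖) ^ 2 := by
      gcongr
      exact hI.2.2
    calc C' * Real.exp (-(ε' * z.im)) * (4 * C * ‖z + Complex.I‖ ^ 2)
        ≤ C' * Real.exp (-(ε' * z.im)) * (4 * C * (1 + ‖z‖) ^ 2) := by gcongr
      _ = _ := by ring
  · refine (hLow z hz).trans ?_
    gcongr
    nlinarith

theorem log_enorm_div_le_iff {w : ℂ} {r x : ℝ} (hr : 0 < r) :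
    ENNReal.log ‖w‖ₑ / (r : EReal) ≤ (x : EReal) ↔ ‖w‖ ≤ Real.exp (x * r) := by
  rw [EReal.div_le_iff_le_mul (by exact_mod_cast hr) (EReal.coe_ne_top r), ← EReal.coe_mul,
    ← Real.log_exp (r * x), ← ENNReal.log_ofReal_of_pos (Real.exp_pos _), ENNReal.log_le_log_iff,
    ← ofReal_norm, ENNReal.ofReal_le_ofReal_iff (Real.exp_pos _).le, mul_comm]

/-- The upper density divides by `2R`, so a count of at most `dR` gives `L/(2π) ≤ d/2`. -/
theorem div_pi_le_of_scaledCountLE {Λ : Set ℂ} {L d : ℝ} (hd : 0 ≤ d)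
    (hdens : upperDensity Λ = ENNReal.ofReal L / ENNReal.ofReal (2 * Real.pi))
    (h : ScaledCountLE Λ (Metric.closedBall 0 1) d) : L / Real.pi ≤ d := by
  have hpi := Real.pi_pos
  have hle : upperDensity Λ ≤ ENNReal.ofReal (d / 2) := by
    apply limsup_le_of_le
    · isBoundedDefault
    filter_upwards [h, eventually_gt_atTop 0] with R hR hR0
    have hcard : ((Λ ∩ Metric.ball 0 R).encard : ℝ≥0∞) ≤ ENNReal.ofReal (d * R) := by
      have h1 : (Λ ∩ Metric.ball 0 R).encard ≤ (⌊d * R⌋₊ : ℕ∞) := by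
        -- The set might a priori be infinite, so a finite subset with one point too many is
        -- extracted.
        by_contra! hcon
        obtain ⟨t, ht, htc⟩ := Set.exists_subset_encard_eq (Order.add_one_le_of_lt hcon)
        have htf : t.Finite := Set.finite_of_encard_eq_coe (k := ⌊d * R⌋₊ + 1) (by
          rw [htc]; push_cast; rfl)
        have h2 := hR htf.toFinset fun l hl => by
          rw [Set.Finite.mem_toFinset] at hl
          refine ⟨(ht hl).1, ?_⟩
          have h3 : ‖l‖ < R := by simpa using (ht hl).2
          rw [mem_closedBall_zero_iff, norm_div, Complex.norm_real, Real.norm_of_nonneg hR0.le,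
            div_le_one hR0]
          exact h3.le
        rw [htf.encard_eq_coe_toFinset_card] at htc
        have h4 : htf.toFinset.card = ⌊d * R⌋₊ + 1 := by exact_mod_cast htc
        rw [h4] at h2
        have := Nat.lt_floor_add_one (d * R)
        push_cast at h2
        linarith
      calc ((Λ ∩ Metric.ball 0 R).encard : ℝ≥0∞) ≤ ((⌊d * R⌋₊ : ℕ∞) : ℝ≥0∞) := by
            exact_mod_cast h1
        _ = ((⌊d * R⌋₊ : ℕ) : ℝ≥0∞) := by simp
        _ = ENNReal.ofReal (⌊d * R⌋₊ : ℝ) := (ENNReal.ofReal_natCast _).symm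
        _ ≤ _ := ENNReal.ofReal_le_ofReal (Nat.floor_le (by positivity))
    calc ((Λ ∩ Metric.ball 0 R).encard : ℝ≥0∞) / ENNReal.ofReal (2 * R)
        ≤ ENNReal.ofReal (d * R) / ENNReal.ofReal (2 * R) := by gcongr
      _ = ENNReal.ofReal (d / 2) := by
        rw [← ENNReal.ofReal_div_of_pos (by positivity)]
        congr 1
        field_simp
  rw [hdens, ← ENNReal.ofReal_div_of_pos (by positivity),
    ENNReal.ofReal_le_ofReal_iff (by positivity)] at hle
  have : L / Real.pi = 2 * (L / (2 * Real.pi)) := by field_simp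
  linarith

/-- The indicator of an entire function whose zeros have the largest density that its growth
allows. -/
theorem indicatorFn_eq {T : ℂ → ℂ} (hT : Differentiable ℂ T) (hne : ∃ z, T z ≠ 0)
    {C L : ℝ} (hC : 1 ≤ C) (hL : 0 < L)
    (hUp : ∀ z : ℂ, 0 ≤ z.im → ‖T z‖ ≤ C * (1 + ‖z‖) ^ 2)
    (hLow : ∀ z : ℂ, z.im ≤ 0 → ‖T z‖ ≤ C * (1 + ‖z‖) ^ 2 * Real.exp (-(L * z.im)))
    (hdens : ∀ d : ℝ, 0 ≤ d → ScaledCountLE {z | T z = 0} (Metric.closedBall 0 1) d →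
      L / Real.pi ≤ d) (θ : ℝ) :
    indicatorFn T θ = ((max 0 (-(L * Real.sin θ)) : ℝ) : EReal) := by
  set m : ℝ := max 0 (-(L * Real.sin θ))
  have hexp : Complex.exp (Complex.I * θ) = Complex.exp (θ * Complex.I) := by rw [mul_comm]
  have hnorm : ∀ r : ℝ, 0 < r → ‖(r : ℂ) * Complex.exp (Complex.I * θ)‖ = r := fun r hr => by
    rw [hexp, norm_mul, Complex.norm_exp_ofReal_mul_I, mul_one, Complex.norm_real,
      Real.norm_of_nonneg hr.le]
  have him : ∀ r : ℝ, ((r : ℂ) * Complex.exp (Complex.I * θ)).im = r * Real.sin θ := fun r => by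
    rw [hexp, im_mul_exp]
  apply le_antisymm
  · rw [← EReal.le_of_forall_lt_iff_le]
    intro q hq
    rw [EReal.coe_lt_coe_iff] at hq
    apply limsup_le_of_le
    · isBoundedDefault
    filter_upwards [eventually_gt_atTop 0, eventually_log_poly_le C 1 (q - m) hC zero_le_one
      (by linarith)] with r hr hpoly
    rw [log_enorm_div_le_iff hr]
    rw [one_mul, Real.log_le_iff_le_exp (by positivity)] at hpoly
    have h1 : ‖T (r * Complex.exp (Complex.I * θ))‖ ≤ C * (1 + r) ^ 2 * Real.exp (m * r) := by
      have hm0 : 0 ≤ m := le_max_left _ _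
      rcases le_total 0 (Real.sin θ) with hs | hs
      · have := hUp (r * Complex.exp (Complex.I * θ)) (by rw [him]; positivity)
        rw [hnorm r hr] at this
        refine this.trans (le_mul_of_one_le_right (by positivity) (Real.one_le_exp (by positivity)))
      · have := hLow (r * Complex.exp (Complex.I * θ)) (by rw [him]; nlinarith)
        rw [hnorm r hr, him] at this
        refine this.trans ?_
        gcongr
        have : -(L * Real.sin θ) ≤ m := le_max_right _ _
        nlinarith
    calc _ ≤ C * (1 + r) ^ 2 * Real.exp (m * r) := h1
      _ ≤ Real.exp ((q - m) * r) * Real.exp (m * r) := by gcongr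
      _ = Real.exp (q * r) := by rw [← Real.exp_add]; ring_nf
  -- An indicator value below `m` means exponential decay along the ray, relative to the growth
  -- permitted in that half-plane.
  · by_contra! hlt
    obtain ⟨q, hq1, hq2⟩ := EReal.lt_iff_exists_real_btwn.1 hlt
    rw [EReal.coe_lt_coe_iff] at hq2
    have hev : ∀ᶠ r : ℝ in atTop,
        ‖T (r * Complex.exp (Complex.I * θ))‖ ≤ Real.exp (q * r) := by
      filter_upwards [eventually_lt_of_limsup_lt hq1, eventually_gt_atTop 0] with r hr hr0
      exact (log_enorm_div_le_iff hr0).1 hr.le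
    have hunit : ∀ u : ℂ, ‖u‖ = 1 → Complex.exp (u.arg * Complex.I) = u := fun u hu => by
      simpa [hu] using Complex.norm_mul_exp_arg_mul_I u
    have hun : ‖Complex.exp (Complex.I * θ)‖ = 1 := by rw [hexp, Complex.norm_exp_ofReal_mul_I]
    have hui : (Complex.exp (Complex.I * θ)).im = Real.sin θ := by
      rw [hexp, Complex.exp_ofReal_mul_I_im]
    set u := Complex.exp (Complex.I * θ)
    rcases le_or_gt 0 (Real.sin θ) with hs | hs
    · have hm : m = 0 := max_eq_left (by have := mul_nonneg hL.le hs; linarith)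
      refine not_decay_on_ray hT hne hC hL hUp hLow hdens (θ := u.arg) (ε := -q)
        (Complex.arg_nonneg_iff.2 (by rw [hui]; exact hs)) (Complex.arg_le_pi u) (by linarith) ?_
      filter_upwards [hev] with r hr
      rw [hunit u hun]
      simpa using hr
    · have hm : m = -(L * Real.sin θ) := max_eq_right (by nlinarith)
      -- `T(-z)e^{iLz}` exchanges the two half-planes and satisfies the same bounds, with reflected
      -- zeros.
      set T' : ℂ → ℂ := fun z => T (-z) * Complex.exp (Complex.I * L * z)
      have hT' : Differentiable ℂ T' := (hT.comp differentiable_neg).mul (by fun_prop)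
      have hn' : ∀ z, ‖T' z‖ = ‖T (-z)‖ * Real.exp (-(L * z.im)) := fun z => by
        rw [norm_mul, norm_exp_I_mul]
      refine not_decay_on_ray hT' ?_ hC hL (fun z hz => ?_) (fun z hz => ?_) (fun d hd h => ?_)
        (θ := (-u).arg) (ε := -(q + L * Real.sin θ))
        (Complex.arg_nonneg_iff.2 (by rw [Complex.neg_im, hui]; linarith))
        (Complex.arg_le_pi _) (by linarith) ?_
      · obtain ⟨z, hz⟩ := hne
        exact ⟨-z, by simpa [T'] using hz⟩
      · have := hLow (-z) (by simpa using hz)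
        rw [norm_neg, Complex.neg_im] at this
        rw [hn']
        calc _ ≤ C * (1 + ‖z‖) ^ 2 * Real.exp (-(L * -z.im)) * Real.exp (-(L * z.im)) := by gcongr
          _ = _ := by rw [mul_assoc, ← Real.exp_add]; simp
      · have := hUp (-z) (by simpa using hz)
        rw [norm_neg] at this
        rw [hn']
        gcongr
      · refine hdens d hd ((h.neg.mono_zeros ?_).mono ?_)
        · intro z hz
          have hz' : T z = 0 := hz
          show T' (-z) = 0
          simp [T', hz']
        · intro z hz
          simpa using hz
      · filter_upwards [hev] with r hr
        rw [hunit (-u) (by rw [norm_neg, hun]), hn']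
        have e : -((r : ℂ) * -u) = r * u := by ring
        have e2 : ((r : ℂ) * -u).im = -(r * Real.sin θ) := by
          rw [mul_neg, Complex.neg_im, him]
        rw [e, e2]
        calc _ ≤ Real.exp (q * r) * Real.exp (-(L * -(r * Real.sin θ))) := by gcongr
          _ = _ := by
            rw [← Real.exp_add]
            ring_nf

/-- A real-linear functional attains its maximum over a segment at an endpoint, here `0` or `iL`. -/
theorem iSup_segment_re (L θ : ℝ) :
    (⨆ ζ ∈ segment ℝ (0 : ℂ) (Complex.I * (L : ℂ)),
      (((ζ * Complex.exp (Complex.I * θ)).re : ℝ) : EReal))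
      = ((max 0 (-(L * Real.sin θ)) : ℝ) : EReal) := by
  have hre : ∀ s : ℝ, ((s • (Complex.I * (L : ℂ))) * Complex.exp (Complex.I * θ)).re
      = s * (-(L * Real.sin θ)) := by
    intro s
    have : (s • (Complex.I * (L : ℂ))) * Complex.exp (Complex.I * θ)
        = Complex.I * (((s * L : ℝ) : ℂ) * Complex.exp (θ * Complex.I)) := by
      rw [Complex.real_smul, mul_comm Complex.I (θ : ℂ)]
      push_cast
      ring
    rw [this, Complex.I_mul_re, im_mul_exp]
    ring
  have hseg : segment ℝ (0 : ℂ) (Complex.I * (L : ℂ))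
      = (fun s : ℝ => s • (Complex.I * (L : ℂ))) '' Icc 0 1 := by
    rw [segment_eq_image]
    simp
  rw [hseg]
  apply le_antisymm
  · refine iSup₂_le fun ζ hζ => ?_
    obtain ⟨s, hs, rfl⟩ := hζ
    rw [EReal.coe_le_coe_iff]
    simp only [hre]
    rcases le_total 0 (-(L * Real.sin θ)) with h | h
    · exact le_max_of_le_right (mul_le_of_le_one_left h hs.2)
    · exact le_max_of_le_left (mul_nonpos_of_nonneg_of_nonpos hs.1 h)
  · rcases max_cases 0 (-(L * Real.sin θ)) with ⟨h, _⟩ | ⟨h, _⟩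
    · rw [h]
      refine le_iSup₂_of_le _ ⟨0, by simp, rfl⟩ ?_
      simp
    · rw [h]
      refine le_iSup₂_of_le _ ⟨1, by simp, rfl⟩ ?_
      simp only [hre, one_mul, le_refl]

theorem hasConjIndicatorDiagram_segment {T : ℂ → ℂ} (hT : Differentiable ℂ T)
    (hne : ∃ z, T z ≠ 0) {C L : ℝ} (hC : 1 ≤ C) (hL : 0 < L)
    (hUp : ∀ z : ℂ, 0 ≤ z.im → ‖T z‖ ≤ C * (1 + ‖z‖) ^ 2)
    (hLow : ∀ z : ℂ, z.im ≤ 0 → ‖T z‖ ≤ C * (1 + ‖z‖) ^ 2 * Real.exp (-(L * z.im)))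
    (hdens : ∀ d : ℝ, 0 ≤ d → ScaledCountLE {z | T z = 0} (Metric.closedBall 0 1) d →
      L / Real.pi ≤ d) :
    HasConjIndicatorDiagram T (segment ℝ (0 : ℂ) (Complex.I * (L : ℂ))) := by
  refine ⟨⟨hT, C, 2 + L, fun z => ?_⟩, ⟨0, left_mem_segment _ _ _⟩, ?_, convex_segment _ _,
    fun θ => ?_⟩
  · have h1 : (1 + ‖z‖) ^ 2 ≤ Real.exp (2 * ‖z‖) := by
      have := Real.add_one_le_exp ‖z‖
      calc (1 + ‖z‖) ^ 2 ≤ Real.exp ‖z‖ ^ 2 := by gcongr; linarith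
        _ = _ := by rw [← Real.exp_nat_mul]; simp
    have h2 : ‖T z‖ ≤ C * (1 + ‖z‖) ^ 2 * Real.exp (L * ‖z‖) := by
      rcases le_total 0 z.im with h | h
      · exact (hUp z h).trans (le_mul_of_one_le_right (by positivity)
          (Real.one_le_exp (by positivity)))
      · refine (hLow z h).trans ?_
        gcongr
        have := (neg_le_abs _).trans (Complex.abs_im_le_norm z)
        nlinarith
    calc ‖T z‖ ≤ C * Real.exp (2 * ‖z‖) * Real.exp (L * ‖z‖) := h2.trans (by gcongr)
      _ = _ := by
        rw [mul_assoc, ← Real.exp_add]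
        ring_nf
  · rw [segment_eq_image]
    exact isCompact_Icc.image (by fun_prop)
  · rw [indicatorFn_eq hT hne hC hL hUp hLow hdens, iSup_segment_re]

/-! ### Growth of `S` and the main theorem. -/

/-- Each product in `S` has one factor from each interval, so the exponents of the endpoints add. -/
theorem norm_generatingFunction_le {a₁ b₁ a₂ b₂ : ℝ} {F₁₁ F₁₂ F₂₁ F₂₂ S : ℂ → ℂ}
    (hF₁₁ : F₁₁ ∈ paleyWienerAddZ (Icc a₁ b₁)) (hF₂₁ : F₂₁ ∈ paleyWienerAddZ (Icc a₁ b₁))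
    (hF₁₂ : F₁₂ ∈ paleyWienerAddZ (Icc a₂ b₂)) (hF₂₂ : F₂₂ ∈ paleyWienerAddZ (Icc a₂ b₂))
    (hS : ∀ z : ℂ, S z = F₁₁ z * F₂₂ z - F₁₂ z * F₂₁ z) :
    ∃ C : ℝ, 1 ≤ C ∧
      (∀ z : ℂ, 0 ≤ z.im → ‖S z‖ ≤ C * (1 + ‖z‖) ^ 2 * Real.exp (-(a₁ + a₂) * z.im)) ∧
      (∀ z : ℂ, z.im ≤ 0 → ‖S z‖ ≤ C * (1 + ‖z‖) ^ 2 * Real.exp (-(b₁ + b₂) * z.im)) := by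
  obtain ⟨C₁, hC₁, p1, q1⟩ := norm_le_of_mem_paleyWienerAddZ hF₁₁
  obtain ⟨C₂, hC₂, p2, q2⟩ := norm_le_of_mem_paleyWienerAddZ hF₂₂
  obtain ⟨C₃, hC₃, p3, q3⟩ := norm_le_of_mem_paleyWienerAddZ hF₁₂
  obtain ⟨C₄, hC₄, p4, q4⟩ := norm_le_of_mem_paleyWienerAddZ hF₂₁
  have key : ∀ (z : ℂ) (s t : ℝ), ‖F₁₁ z‖ ≤ C₁ * (1 + ‖z‖) * Real.exp (-s * z.im) →
      ‖F₂₂ z‖ ≤ C₂ * (1 + ‖z‖) * Real.exp (-t * z.im) →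
      ‖F₁₂ z‖ ≤ C₃ * (1 + ‖z‖) * Real.exp (-t * z.im) →
      ‖F₂₁ z‖ ≤ C₄ * (1 + ‖z‖) * Real.exp (-s * z.im) →
      ‖S z‖ ≤ (C₁ * C₂ + C₃ * C₄ + 1) * (1 + ‖z‖) ^ 2 * Real.exp (-(s + t) * z.im) := by
    intro z s t h1 h2 h3 h4
    have e : Real.exp (-(s + t) * z.im) = Real.exp (-s * z.im) * Real.exp (-t * z.im) := by
      rw [← Real.exp_add]
      ring_nf
    have hm1 : ‖F₁₁ z‖ * ‖F₂₂ z‖ ≤ C₁ * (1 + ‖z‖) * Real.exp (-s * z.im)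
        * (C₂ * (1 + ‖z‖) * Real.exp (-t * z.im)) := by gcongr
    have hm2 : ‖F₁₂ z‖ * ‖F₂₁ z‖ ≤ C₃ * (1 + ‖z‖) * Real.exp (-t * z.im)
        * (C₄ * (1 + ‖z‖) * Real.exp (-s * z.im)) := by gcongr
    rw [hS, e]
    have hpos : 0 ≤ (1 + ‖z‖) ^ 2 * (Real.exp (-s * z.im) * Real.exp (-t * z.im)) := by positivity
    refine (norm_sub_le _ _).trans ?_
    rw [norm_mul, norm_mul]
    linarith
  exact ⟨C₁ * C₂ + C₃ * C₄ + 1, by linarith [mul_nonneg hC₁ hC₂, mul_nonneg hC₃ hC₄],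
    fun z hz => key z _ _ (p1 z hz) (p2 z hz) (p3 z hz) (p4 z hz),
    fun z hz => key z _ _ (q1 z hz) (q2 z hz) (q3 z hz) (q4 z hz)⟩

/-- Here `Fₖⱼ` is the component of `Fₖ` with spectrum in the interval number `j`. -/
theorem mainTheorem4 (a₁ b₁ a₂ b₂ : ℝ) (hab₁ : a₁ < b₁) (hab₂ : a₂ < b₂)
    (hdisj : Disjoint (Set.Icc a₁ b₁) (Set.Icc a₂ b₂))
    (E : Set ℝ) (hE : E = Set.Icc a₁ b₁ ∪ Set.Icc a₂ b₂)
    (Λ : Set ℂ) (hcomplete : KernelsComplete E Λ) (hminimal : KernelsMinimal E Λ)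
    (hdens : upperDensity Λ = volume E / ENNReal.ofReal (2 * Real.pi))
    (f : ℂ → ℂ → ℂ) (hf : IsBiorthogonal E Λ f)
    (l₁ l₂ : ℂ) (hl₁ : l₁ ∈ Λ) (hl₂ : l₂ ∈ Λ)
    (F₁ F₂ : ℂ → ℂ)
    (hF₁ : ∀ z : ℂ, F₁ z = (z - l₁) * f l₁ z)
    (hF₂ : ∀ z : ℂ, F₂ z = (z - l₂) * f l₂ z)
    (hind : LinearIndependent ℂ ![F₁, F₂])
    (F₁₁ F₁₂ F₂₁ F₂₂ : ℂ → ℂ)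
    (hF₁₁ : F₁₁ ∈ paleyWienerAddZ (Set.Icc a₁ b₁))
    (hF₂₁ : F₂₁ ∈ paleyWienerAddZ (Set.Icc a₁ b₁))
    (hF₁₂ : F₁₂ ∈ paleyWienerAddZ (Set.Icc a₂ b₂))
    (hF₂₂ : F₂₂ ∈ paleyWienerAddZ (Set.Icc a₂ b₂))
    (hdec₁ : ∀ z : ℂ, F₁ z = F₁₁ z + F₁₂ z)
    (hdec₂ : ∀ z : ℂ, F₂ z = F₂₁ z + F₂₂ z)
    (S : ℂ → ℂ) (hS : ∀ z : ℂ, S z = F₁₁ z * F₂₂ z - F₁₂ z * F₂₁ z) :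
    (∃ c : ℂ → ℂ, ∀ l ∈ Λ, c l ≠ 0 ∧ ∀ z : ℂ, z ≠ l →
      f l z = c l * ((F₁₁ l * F₂ z - F₂₁ l * F₁ z) / (z - l)) ∧
      f l z = c l * ((F₂₂ l * F₁ z - F₁₂ l * F₂ z) / (z - l))) ∧
    (∀ z : ℂ, S z = F₁₁ z * F₂ z - F₂₁ z * F₁ z) ∧
    (∀ z : ℂ, S z = 0 ↔ z ∈ Λ) ∧
    (∀ l ∈ Λ, analyticOrderAt S l = 1) ∧
    (∃ t : ℝ, HasConjIndicatorDiagram (fun z : ℂ => Complex.exp (Complex.I * t * z) * S z)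
      (segment ℝ (0 : ℂ) (Complex.I * ((volume.real E : ℝ) : ℂ)))) := by
  have hK : IsCompact E := hE ▸ isCompact_union_Icc
  have hz₁ : ∀ l ∈ Λ, F₁ l = 0 := fun l hl => by
    rw [hF₁, biorthogonal_apply hK hf hl hl₁]
    split_ifs with h
    · simp [h]
    · simp
  have hz₂ : ∀ l ∈ Λ, F₂ l = 0 := fun l hl => by
    rw [hF₂, biorthogonal_apply hK hf hl hl₂]
    split_ifs with h
    · simp [h]
    · simp
  have hc : KernelsComplete (Icc a₁ b₁ ∪ Icc a₂ b₂) Λ := hE ▸ hcomplete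
  have hSF := generatingFunction_eq hdec₁ hdec₂ hS
  have hzero := generatingFunction_eq_zero_iff hc hind hF₁₁ hF₂₁ hF₁₂ hF₂₂ hdec₁ hdec₂ hz₁ hz₂ hS
  have hord : ∀ l ∈ Λ, analyticOrderAt S l = 1 := fun l hl =>
    analyticOrderAt_generatingFunction hc hind hF₁₁ hF₂₁ hF₁₂ hF₂₂ hdec₁ hdec₂ hz₁ hz₂ hS hl
  have hSd := differentiable_generatingFunction hF₁₁ hF₂₁ hF₁₂ hF₂₂ hS
  refine ⟨?_, hSF, hzero, hord, ?_⟩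
  · have hgen : ∀ l ∈ Λ, ∃ c : ℂ, c ≠ 0 ∧ ∀ z : ℂ, z ≠ l →
        f l z = c * ((F₁₁ l * F₂ z - F₂₁ l * F₁ z) / (z - l)) := by
      intro l hl
      obtain ⟨v, hv, h, hv0⟩ :=
        exists_generator hc hind hF₁₁ hF₂₁ hF₁₂ hF₂₂ hdec₁ hdec₂ hz₁ hz₂ hl
      refine ⟨(v l)⁻¹, inv_ne_zero hv0, fun z hz => ?_⟩
      have hfl : f l ∈ paleyWiener (Icc a₁ b₁ ∪ Icc a₂ b₂) := hE ▸ hf.1 l hl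
      -- `v - v(l) f_l` vanishes on all of `Λ`, since `f_l(l) = 1`; hence `v = v(l) f_l`.
      have hvf := eq_zero_of_kernelsComplete isCompact_union_Icc hc
        (paleyWiener_sub isCompact_union_Icc hv (paleyWiener_const_mul hfl (v l))) (fun μ hμ => by
          rw [biorthogonal_apply hK hf hμ hl]
          split_ifs with hμl
          · simp [hμl]
          · have := h μ
            rw [hz₁ μ hμ, hz₂ μ hμ] at this
            simpa [sub_ne_zero.2 hμl] using this.symm) z
      rw [h z, mul_div_cancel_left₀ _ (sub_ne_zero.2 hz), sub_eq_zero.1 hvf,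
        inv_mul_cancel_left₀ hv0]
    choose! c hc0 hcf using hgen
    refine ⟨c, fun l hl => ⟨hc0 l hl, fun z hz => ⟨hcf l hl z hz, ?_⟩⟩⟩
    have e1 : F₁₂ l = -F₁₁ l := by linear_combination hz₁ l hl - hdec₁ l
    have e2 : F₂₂ l = -F₂₁ l := by linear_combination hz₂ l hl - hdec₂ l
    rw [hcf l hl z hz, e1, e2]
    congr 2
    ring
  · have hS0 : ∃ z, S z ≠ 0 := by
      by_contra! h
      have h1 := hord l₁ hl₁
      rw [analyticOrderAt_eq_top.2 (Eventually.of_forall h)] at h1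
      exact absurd h1 (by simp)
    have hvol : volume E = ENNReal.ofReal (b₁ - a₁ + (b₂ - a₂)) := by
      rw [hE, measure_union hdisj measurableSet_Icc, Real.volume_Icc, Real.volume_Icc,
        ENNReal.ofReal_add (by linarith) (by linarith)]
    have hreal : volume.real E = b₁ - a₁ + (b₂ - a₂) := by
      rw [measureReal_def, hvol, ENNReal.toReal_ofReal (by linarith)]
    obtain ⟨C, hC, hUp, hLow⟩ := norm_generatingFunction_le hF₁₁ hF₂₁ hF₁₂ hF₂₂ hS
    rw [hreal]
    -- This `t` brings the type in the upper half-plane to `0` and in the lower one to `b₁ + b₂ - a₁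
    -- - a₂ = |E|`.
    refine ⟨-(a₁ + a₂), hasConjIndicatorDiagram_segment
      (T := fun z : ℂ => Complex.exp (Complex.I * ((-(a₁ + a₂) : ℝ) : ℂ) * z) * S z) (C := C)
      (Differentiable.mul (by fun_prop) hSd) ?_ hC (by linarith) (fun z hz => ?_) (fun z hz => ?_)
      (fun d hd h => ?_)⟩
    · obtain ⟨z, hz⟩ := hS0
      exact ⟨z, mul_ne_zero (Complex.exp_ne_zero _) hz⟩
    · rw [norm_mul, norm_exp_I_mul]
      calc _ ≤ Real.exp (-(-(a₁ + a₂) * z.im))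
            * (C * (1 + ‖z‖) ^ 2 * Real.exp (-(a₁ + a₂) * z.im)) := by gcongr; exact hUp z hz
        _ = _ := by
          rw [mul_left_comm, ← Real.exp_add]
          simp
    · rw [norm_mul, norm_exp_I_mul]
      calc _ ≤ Real.exp (-(-(a₁ + a₂) * z.im))
            * (C * (1 + ‖z‖) ^ 2 * Real.exp (-(b₁ + b₂) * z.im)) := by gcongr; exact hLow z hz
        _ = _ := by
          rw [mul_left_comm, ← Real.exp_add]
          ring_nf
    · refine div_pi_le_of_scaledCountLE hd (hvol ▸ hdens) (h.mono_zeros fun z hz => ?_)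
      show Complex.exp _ * S z = 0
      rw [(hzero z).2 hz, mul_zero]
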